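/- Let $\mathbb{D}_r=\{z\in\mathbb{C}:|z|<r\}$ and $\mathbb{D}=\mathbb{D}_1$. Let $f=h+\overline{g}$ be harmonic in $\mathbb{D}$, where $h$ and $g$ are analytic in $\mathbb{D}$ with $h(0)=0$, $h'(0)=1$ and $g(0)=0$. Suppose that $h$ is injective in $\mathbb{D}$ and that $g(z)=w(z)h(z)$ for all $z\in\mathbb{D}$, where $w$ is analytic in $\mathbb{D}$ with $|w(z)|\le 1$ in $\mathbb{D}$, and $w$ is not a constant of modulus one. Then $f$ is sense-preserving in $\mathbb{D}_{2-\sqrt{3}}$, that is, its Jacobian $J_f=|h'|^2-|g'|^2$ is positive there, and $f$ is injective in $\mathbb{D}_{2-\sqrt{3}}$. The result is sharp: for every $r$ with $2-\sqrt{3}<r\le 1$ there is a mapping $f$ satisfying all the above hypotheses which is neither sense-preserving nor injective in $\mathbb{D}_r$. -/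

import Mathlib

open scoped ComplexConjugate

/-- The open disk of radius `r` about `0` in the complex plane. -/
def disk (r : ℝ) : Set ℂ := Metric.ball (0 : ℂ) r

/-- `f` is a normalized complex-valued harmonic mapping of the open unit disk with analytic part
`h` and co-analytic part `g`: `f = h + conj g` is harmonic in the unit disk, `h` and `g` are
holomorphic there, `h(0) = 0`, `h'(0) = 1` and `g(0) = 0`. -/
structure IsNormalizedHarmonic (f h g : ℂ → ℂ) : Prop where
  harmonic : InnerProductSpace.HarmonicOnNhd f (disk 1)
  holo_h : DifferentiableOn ℂ h (disk 1)
  holo_g : DifferentiableOn ℂ g (disk 1)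
  decomp : ∀ z ∈ disk 1, f z = h z + conj (g z)
  h_zero : h 0 = 0
  deriv_h_zero : deriv h 0 = 1
  g_zero : g 0 = 0

/-- The class of holomorphic functions on the unit disk bounded by one in modulus. -/
structure IsBoundedByOne (w : ℂ → ℂ) : Prop where
  holo : DifferentiableOn ℂ w (disk 1)
  norm_le : ∀ z ∈ disk 1, ‖w z‖ ≤ 1

/-- `w` is, on the unit disk, a constant of modulus one. -/
def IsUnimodularConstant (w : ℂ → ℂ) : Prop :=
  ∃ c : ℂ, ‖c‖ = 1 ∧ ∀ z ∈ disk 1, w z = c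

/-- `f` is one of the harmonic mappings under study, with analytic part `h`, co-analytic part `g`
and multiplier `w`: it is normalized, `h` is injective, and `g = w h` with `w` holomorphic and
bounded by one, but not a constant of modulus one. -/
structure IsMultiplierMapping (f h g w : ℂ → ℂ) : Prop where
  normalized : IsNormalizedHarmonic f h g
  injOn_h : Set.InjOn h (disk 1)
  bounded_w : IsBoundedByOne w
  not_unimodular : ¬ IsUnimodularConstant w
  g_eq : ∀ z ∈ disk 1, g z = w z * h z

/-- The Jacobian of `f`, as a mapping of the real plane, at `z`. -/
noncomputable def jacobian (f : ℂ → ℂ) (z : ℂ) : ℝ := (fderiv ℝ f z).det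

/-- `f` is sense-preserving on `s`: its Jacobian is positive there. -/
def SensePreservingOn (f : ℂ → ℂ) (s : Set ℂ) : Prop := ∀ z ∈ s, 0 < jacobian f z

/-- The Jacobian of `h + conj g` is `|h'|² - |g'|²`. -/
theorem IsNormalizedHarmonic.jacobian_eq {f h g : ℂ → ℂ} (hf : IsNormalizedHarmonic f h g)
    {z : ℂ} (hz : z ∈ disk 1) : jacobian f z = ‖deriv h z‖ ^ 2 - ‖deriv g z‖ ^ 2 := by
  have hn : disk 1 ∈ nhds z := Metric.isOpen_ball.mem_nhds hz
  have hh := ((hf.holo_h.differentiableAt hn).hasDerivAt.hasFDerivAt).restrictScalars ℝ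
  have hg := ((hf.holo_g.differentiableAt hn).hasDerivAt.hasFDerivAt).restrictScalars ℝ
  have hc := (Complex.conjCLE.toContinuousLinearMap.hasFDerivAt (x := g z)).comp z hg
  have he := (hh.add hc).congr_of_eventuallyEq
    (f₁ := f) (Filter.eventually_of_mem hn fun x hx => hf.decomp x hx)
  unfold jacobian
  rw [he.fderiv, ContinuousLinearMap.det, ← LinearMap.det_toMatrix Complex.basisOneI,
    Matrix.det_fin_two]
  simp [LinearMap.toMatrix_apply, ← Complex.normSq_eq_norm_sq, Complex.normSq_apply]
  ring

open Metric Set Filter Topology MeasureTheory Complex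

/-! Sense-preservation is a bound on `g' = w' h + w h'`. With `r = |z|` and `x = |w z|`,
Schwarz–Pick gives `|w'| ≤ (1 - x²) / (1 - r²)`, and the growth estimate
`norm_mul_le_norm_deriv_mul` gives `|h / h'| ≤ r (1 + r) / (1 - r)`. Hence `|g'| ≤ |h'| (x + (1 -
x²) r / (1 - r)²)`. Since `x < 1`, this is less than `|h'|` as soon as `2 r < (1 - r)²`, that is `r²
- 4 r + 1 > 0`, and `2 - √3` is the smaller root of this quadratic.

The same number is the radius of convexity of univalent functions. If `|z₁|, |z₂| ≤ ρ < 2 - √3`,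
then `g ∘ h⁻¹` is defined on the convex set `h (closedBall 0 ρ)`, where its derivative `g' / h'` is
bounded by some `C < 1`, so it is a strict contraction. But `f z₁ = f z₂` forces `|g z₁ - g z₂| = |h
z₁ - h z₂|`; hence `h z₁ = h z₂` and `z₁ = z₂`.

Growth and convexity both follow from the pre-Schwarzian inequality `norm_preSchwarzian_sub_le`,
which is Bieberbach's `|h'' 0| ≤ 4` applied to a Koebe transform of `h`. Bieberbach's inequality is
the first-coefficient area theorem for the odd function `1 / √(h (z²))`. The area theorem is proved
without boundary curves: a maximum principle confines the image of an annulus to a disk, and its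
area is compared with the area of that disk.

For sharpness, the Koebe function with a Blaschke factor vanishing near `1` gives an `f` that is
real on the real axis, where its derivative is positive at `0` but negative at some `-ρ` with `ρ`
between `2 - √3` and `r`. -/

/-! ### Nonvanishing of the derivative of an injective function -/

/-- An injective holomorphic function has nonvanishing derivative. -/
theorem deriv_ne_zero_of_injOn {f : ℂ → ℂ} {U : Set ℂ} (hU : IsOpen U)
    (hf : DifferentiableOn ℂ f U) (hinj : InjOn f U) {z₀ : ℂ} (hz₀ : z₀ ∈ U) :
    deriv f z₀ ≠ 0 := by
  have hUn : U ∈ 𝓝 z₀ := hU.mem_nhds hz₀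
  have han : AnalyticAt ℂ (fun z => f z - f z₀) z₀ := (hf.analyticAt hUn).sub analyticAt_const
  have hne : ¬ ∀ᶠ z in 𝓝 z₀, f z - f z₀ = 0 := by
    intro h
    obtain ⟨z, ⟨hz, hzU⟩, hzne⟩ :=
      (((h.and hUn).filter_mono nhdsWithin_le_nhds).and
        (self_mem_nhdsWithin : {z₀}ᶜ ∈ 𝓝[≠] z₀)).exists
    exact hzne (hinj hzU hz₀ (sub_eq_zero.mp hz))
  obtain ⟨n, u, hu, hu0, hfu⟩ := han.exists_eventuallyEq_pow_smul_nonzero_iff.mpr hne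
  have hn0 : n ≠ 0 := by
    rintro rfl
    have := hfu.self_of_nhds
    simp at this
    exact hu0 this.symm
  -- An `n`-th root of `u`, divided by `u z₀` so that the base is near `1`, away from the branch
  -- cut. Then `f - f z₀ = u z₀ * φ ^ n` with `φ` a local coordinate at `z₀`.
  set v : ℂ → ℂ := fun z => (u z / u z₀) ^ (1 / n : ℂ) with hv
  have hv0 : v z₀ = 1 := by simp [hv, hu0]
  have hva : AnalyticAt ℂ v z₀ := by
    refine (hu.div_const).cpow analyticAt_const ?_
    simp [hu0]
  have hvn : ∀ z, v z ^ n = u z / u z₀ := fun z => by simp [hv, ← cpow_mul_nat, hn0]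
  set φ : ℂ → ℂ := fun z => (z - z₀) * v z with hφ
  have hφa : AnalyticAt ℂ φ z₀ := (analyticAt_id.sub analyticAt_const).mul hva
  have hφd : HasDerivAt φ 1 z₀ := by
    have := ((hasDerivAt_id z₀).sub_const z₀).mul hva.differentiableAt.hasDerivAt
    exact this.congr_deriv (by simp [hv0])
  have hφs : HasStrictDerivAt φ 1 z₀ := by
    have := hφa.hasStrictDerivAt
    rwa [hφd.deriv] at this
  have hmap : map φ (𝓝 z₀) = 𝓝 0 := by
    have := hφs.map_nhds_eq one_ne_zero
    simpa [hφ] using this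
  have hfφ : ∀ᶠ z in 𝓝 z₀, f z - f z₀ = u z₀ * φ z ^ n := by
    filter_upwards [hfu] with z hz
    rw [hz, hφ]
    simp only [mul_pow, hvn, smul_eq_mul]
    field_simp
  have himg : φ '' {z | z ∈ U ∧ f z - f z₀ = u z₀ * φ z ^ n} ∈ 𝓝 (0 : ℂ) := by
    rw [← hmap]
    exact image_mem_map (Filter.inter_mem hUn hfφ)
  have hn1 : n = 1 := by
    by_contra hn1
    -- The coordinate values `t` and `ω t` have the same `n`-th power, so injectivity of `f` forces
    -- `ω = 1`.
    set ω : ℂ := exp (2 * Real.pi * I / n) with hω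
    have hωp : IsPrimitiveRoot ω n := isPrimitiveRoot_exp n hn0
    have h1 : ∀ᶠ t : ℂ in 𝓝 0, t ∈ φ '' {z | z ∈ U ∧ f z - f z₀ = u z₀ * φ z ^ n} := himg
    have h2 : ∀ᶠ t : ℂ in 𝓝 0, ω * t ∈ φ '' {z | z ∈ U ∧ f z - f z₀ = u z₀ * φ z ^ n} := by
      have : Tendsto (fun t : ℂ => ω * t) (𝓝 0) (𝓝 0) := by
        have : Continuous fun t : ℂ => ω * t := by fun_prop
        simpa using this.tendsto 0
      exact this.eventually h1
    obtain ⟨t, ⟨⟨z₁, ⟨hz₁U, hz₁⟩, e₁⟩, ⟨z₂, ⟨hz₂U, hz₂⟩, e₂⟩⟩, ht⟩ :=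
      (((h1.and h2).filter_mono nhdsWithin_le_nhds).and
        (self_mem_nhdsWithin : {(0 : ℂ)}ᶜ ∈ 𝓝[≠] (0 : ℂ))).exists
    have : z₁ = z₂ := by
      apply hinj hz₁U hz₂U
      have : f z₁ - f z₀ = f z₂ - f z₀ := by
        rw [hz₁, hz₂, e₁, e₂, mul_pow, hωp.pow_eq_one, one_mul]
      simpa using this
    rw [this, e₂] at e₁
    have hω1 : ω = 1 := by
      have ht : t ≠ 0 := ht
      exact mul_right_cancel₀ ht (by rw [e₁, one_mul])
    have := hωp.dvd_of_pow_eq_one 1 (by simpa using hω1)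
    exact hn1 (Nat.dvd_one.mp this)
  subst hn1
  have hd : HasDerivAt (fun z => f z - f z₀) (u z₀) z₀ := by
    have : HasDerivAt (fun z => u z₀ * φ z ^ 1) (u z₀) z₀ := by
      simpa using hφd.const_mul (u z₀)
    exact this.congr_of_eventuallyEq hfφ
  have hd' : HasDerivAt f (u z₀) z₀ := by simpa using hd.add_const (f z₀)
  rw [hd'.deriv]
  exact hu0

/-! ### The area theorem -/

/-- The real derivative of `p + conj q`. -/
theorem hasFDerivAt_add_conj {p q : ℂ → ℂ} {p' q' z : ℂ} (hp : HasDerivAt p p' z)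
    (hq : HasDerivAt q q' z) :
    ∃ L : ℂ →L[ℝ] ℂ, HasFDerivAt (fun x => p x + conj (q x)) L z ∧
      L.det = ‖p'‖ ^ 2 - ‖q'‖ ^ 2 := by
  have hh := hp.hasFDerivAt.restrictScalars ℝ
  have hg := hq.hasFDerivAt.restrictScalars ℝ
  have hc := (Complex.conjCLE.toContinuousLinearMap.hasFDerivAt (x := q z)).comp z hg
  refine ⟨_, hh.add hc, ?_⟩
  rw [ContinuousLinearMap.det, ← LinearMap.det_toMatrix Complex.basisOneI, Matrix.det_fin_two]
  simp [LinearMap.toMatrix_apply, ← Complex.normSq_eq_norm_sq, Complex.normSq_apply]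
  ring

/-- A linear functional of `1 / z + k z`, where this function is injective on the punctured disk,
is bounded on the annulus outside a circle by its bound on the circle. -/
theorem re_mul_inv_add_le {k : ℂ → ℂ} (hk : DifferentiableOn ℂ k (ball 0 1))
    (hinj : InjOn (fun z => z⁻¹ + k z) (ball 0 1 \ {0})) {ε M : ℝ} (hε : 0 < ε)
    {α : ℂ} (hM : ∀ ζ : ℂ, ‖ζ‖ = ε → (α * (ζ⁻¹ + k ζ)).re ≤ M) {z : ℂ} (hz : ε ≤ ‖z‖)
    (hz1 : ‖z‖ < 1) : (α * (z⁻¹ + k z)).re ≤ M := by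
  by_contra! hlt
  have hε1 : ε < 1 := hz.trans_lt hz1
  have hzε : ε < ‖z‖ := by
    refine lt_of_le_of_ne hz fun h => ?_
    exact absurd (hM z h.symm) (not_le.mpr hlt)
  set c : ℂ := z⁻¹ + k z with hc
  have hα : α ≠ 0 := by
    rintro rfl
    have := hM ε (by simp [abs_of_pos hε])
    simp at this hlt
    linarith
  -- With `G ζ = ζ⁻¹ + k ζ` and `c = G z`, `ζ / D ζ` extends `1 / (G ζ - c)` over the pole;
  -- injectivity of `G` keeps `D` from vanishing on the closed disk. On the circle `Re (α (G - c)) <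
  -- 0`, so `exp (1 / (α (G - c)))` has modulus below `1` there, yet it equals `1` at the centre.
  -- This contradicts the maximum principle.
  set D : ℂ → ℂ := fun ζ => 1 + ζ * (k ζ - c) with hD
  have hDeq : ∀ ζ, ζ ≠ 0 → D ζ = ζ * (ζ⁻¹ + k ζ - c) := by
    intro ζ h
    simp only [hD]
    field_simp
    ring
  have hD0 : ∀ ζ ∈ closedBall (0 : ℂ) ε, D ζ ≠ 0 := by
    intro ζ hζ
    rw [mem_closedBall_zero_iff] at hζ
    by_cases h : ζ = 0
    · simp [hD, h]
    · rw [hDeq ζ h]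
      refine mul_ne_zero h (sub_ne_zero.mpr fun heq => ?_)
      have hz0 : z ≠ 0 := by
        rintro rfl
        simp at hzε
        linarith
      have := @hinj ζ ⟨by simpa using hζ.trans_lt hε1, h⟩ z
        ⟨by simpa using hz1, hz0⟩ heq
      rw [this] at hζ
      linarith
  have hsub : closedBall (0 : ℂ) ε ⊆ ball 0 1 := closedBall_subset_ball hε1
  have hdiff : DifferentiableOn ℂ (fun ζ => exp (ζ / (α * D ζ))) (closedBall 0 ε) := by
    have hk' := hk.mono hsub
    have : DifferentiableOn ℂ D (closedBall 0 ε) := by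
      simp only [hD]; fun_prop
    refine DifferentiableOn.cexp (differentiableOn_id.div (this.const_mul α) ?_)
    exact fun ζ hζ => mul_ne_zero hα (hD0 ζ hζ)
  have hcl : DiffContOnCl ℂ (fun ζ => exp (ζ / (α * D ζ))) (ball 0 ε) := by
    apply DifferentiableOn.diffContOnCl
    rwa [closure_ball _ hε.ne']
  obtain ⟨ζ, hζ, hmax⟩ := exists_mem_frontier_isMaxOn_norm isBounded_ball
    ⟨0, mem_ball_self hε⟩ hcl
  rw [frontier_ball _ hε.ne', mem_sphere_zero_iff_norm] at hζ
  have h0 := hmax (subset_closure (mem_ball_self hε))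
  simp only [Function.comp_apply, zero_div, norm_exp, mem_ofPred_eq, zero_re, Real.exp_le_exp] at h0
  have hζ0 : ζ ≠ 0 := by
    rintro rfl
    simp at hζ
    linarith
  have hre : (α * (ζ⁻¹ + k ζ - c)).re < 0 := by
    have := hM ζ hζ
    rw [mul_sub, sub_re]
    linarith
  rw [hDeq ζ hζ0, mul_left_comm, ← div_div, div_self hζ0, one_div, inv_re] at h0
  have : 0 < normSq (α * (ζ⁻¹ + k ζ - c)) := by
    rw [normSq_pos]
    rintro h
    rw [h] at hre
    simp at hre
  exact absurd h0 (not_le.mpr (div_neg_of_neg_of_pos hre this))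

/-- Integration over a closed annulus in polar coordinates. -/
theorem setIntegral_annulus_eq {F : ℂ → ℝ} {ε ρ : ℝ} (hε : 0 < ε) (hερ : ε ≤ ρ)
    (hF : ContinuousOn F {z | ‖z‖ ∈ Icc ε ρ}) :
    IntervalIntegrable (fun r => r * (2 * Real.pi * Real.circleAverage F 0 r)) volume ε ρ ∧
    ∫ z in {z : ℂ | ‖z‖ ∈ Icc ε ρ}, F z =
      ∫ r in ε..ρ, r * (2 * Real.pi * Real.circleAverage F 0 r) := by
  have hmeas : MeasurableSet {z : ℂ | ‖z‖ ∈ Icc ε ρ} := measurableSet_Icc.preimage measurable_norm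
  rw [← integral_indicator hmeas, ← Complex.integral_comp_polarCoord_symm]
  have hind : ∀ p ∈ polarCoord.target,
      p.1 • ({z : ℂ | ‖z‖ ∈ Icc ε ρ}.indicator F (Complex.polarCoord.symm p)) =
        (Icc ε ρ ×ˢ Ioo (-Real.pi) Real.pi).indicator
          (fun p : ℝ × ℝ => p.1 * F (circleMap 0 p.1 p.2)) p := by
    rintro ⟨r, θ⟩ ⟨hr, hθ⟩
    have hr : 0 < r := hr
    have e : Complex.polarCoord.symm (r, θ) = circleMap 0 r θ := by
      simp [circleMap, exp_mul_I]
    rw [e]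
    by_cases h : r ∈ Icc ε ρ
    · rw [indicator_of_mem, indicator_of_mem, smul_eq_mul]
      · exact ⟨h, hθ⟩
      · simpa [abs_of_pos hr] using h
    · rw [indicator_of_notMem, indicator_of_notMem, smul_zero]
      · exact fun h' => h h'.1
      · simpa [abs_of_pos hr] using h
  rw [setIntegral_congr_fun polarCoord.open_target.measurableSet hind,
    setIntegral_indicator (measurableSet_Icc.prod measurableSet_Ioo)]
  have hsub : polarCoord.target ∩ Icc ε ρ ×ˢ Ioo (-Real.pi) Real.pi =
      Icc ε ρ ×ˢ Ioo (-Real.pi) Real.pi := by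
    apply inter_eq_right.mpr
    rintro ⟨r, θ⟩ ⟨hr, hθ⟩
    exact ⟨hε.trans_le hr.1, hθ⟩
  have hcont : ContinuousOn (fun p : ℝ × ℝ => p.1 * F (circleMap 0 p.1 p.2))
      (Icc ε ρ ×ˢ Icc (-Real.pi) Real.pi) := by
    refine continuousOn_fst.mul (hF.comp (t := {z | ‖z‖ ∈ Icc ε ρ}) ?_ ?_)
    · apply Continuous.continuousOn
      unfold circleMap
      fun_prop
    · rintro ⟨r, θ⟩ ⟨hr, -⟩
      simpa [abs_of_pos (hε.trans_le hr.1)] using hr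
  have hint : IntegrableOn (fun p : ℝ × ℝ => p.1 * F (circleMap 0 p.1 p.2))
      (Icc ε ρ ×ˢ Ioo (-Real.pi) Real.pi) :=
    (hcont.integrableOn_compact (isCompact_Icc.prod isCompact_Icc)).mono_set
      (prod_mono_right Ioo_subset_Icc_self)
  have hinner : ∀ r, ∫ θ in Ioo (-Real.pi) Real.pi, r * F (circleMap 0 r θ) =
      r * (2 * Real.pi * Real.circleAverage F 0 r) := by
    intro r
    -- Polar coordinates use angles in `(-π, π)`, the circle average uses `[0, 2π]`; hence the shift
    -- by `-π`.
    rw [← integral_Ioc_eq_integral_Ioo,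
      ← intervalIntegral.integral_of_le (by linarith [Real.pi_pos]),
      intervalIntegral.integral_const_mul, Real.circleAverage_eq_integral_add (-Real.pi),
      intervalIntegral.integral_comp_add_right (fun θ => F (circleMap 0 r θ)), smul_eq_mul,
      mul_inv_cancel_left₀ (by positivity)]
    congr 2
    · ring
    · ring
  rw [Measure.volume_eq_prod] at hint
  rw [hsub, Measure.volume_eq_prod, setIntegral_prod _ hint,
    intervalIntegral.integral_of_le hερ, ← integral_Icc_eq_integral_Ioc]
  refine ⟨?_, setIntegral_congr_fun measurableSet_Icc fun r _ => hinner r⟩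
  rw [intervalIntegrable_iff_integrableOn_Icc_of_le hερ]
  rw [IntegrableOn, ← Measure.prod_restrict] at hint
  have := hint.integral_prod_left
  simp only [hinner] at this
  exact this

/-- Lower bound for the mean square on a circle of the derivative of `1 / z + k z`. -/
theorem le_circleAverage_sq {l : ℂ → ℂ} (hl : DifferentiableOn ℂ l (ball 0 1)) {r : ℝ} (hr : 0 < r)
    (hr1 : r < 1) :
    1 / r ^ 4 + ‖l 0‖ ^ 2 ≤ Real.circleAverage (fun z => ‖-(z ^ 2)⁻¹ + l z‖ ^ 2) 0 r := by
  have hsub : closedBall (0 : ℂ) r ⊆ ball 0 1 := closedBall_subset_ball hr1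
  set b := l 0 with hb
  -- On `|z| = r` one has `(z²)⁻¹ = conj (z² / r⁴)`. Expanding the square around `b` leaves `1 / r⁴
  -- + |b|² + Re ψ + |l - b|²` with `ψ` holomorphic and `ψ 0 = 0`, so `Re ψ` has mean zero and the
  -- last term can be dropped.
  set ψ : ℂ → ℂ := fun z =>
    -2 * b * z ^ 2 / r ^ 4 + 2 * (conj b - z ^ 2 / r ^ 4) * (l z - b) with hψ
  have hψd : DiffContOnCl ℂ ψ (ball 0 |r|) := by
    apply DifferentiableOn.diffContOnCl
    rw [abs_of_pos hr, closure_ball _ hr.ne']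
    have := hl.mono hsub
    simp only [hψ]
    fun_prop
  have hψ0 : Real.circleAverage ψ 0 r = 0 := by
    rw [hψd.circleAverage]
    simp [hψ, hb]
  have hsph : sphere (0 : ℂ) |r| ⊆ ball 0 1 := by
    rw [abs_of_pos hr]; exact sphere_subset_closedBall.trans hsub
  have hψi : CircleIntegrable ψ 0 r := by
    apply ContinuousOn.circleIntegrable'
    rw [abs_of_pos hr]
    refine hψd.continuousOn.mono ?_
    rw [abs_of_pos hr, closure_ball _ hr.ne']
    exact sphere_subset_closedBall
  have hre : Real.circleAverage (fun z => (ψ z).re) 0 r = 0 := by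
    have := Complex.reCLM.intervalIntegral_comp_comm hψi
    rw [Real.circleAverage_def] at hψ0 ⊢
    simp only [Complex.reCLM_apply] at this
    rw [this]
    have h2 : (∫ θ in (0 : ℝ)..2 * Real.pi, ψ (circleMap 0 r θ)) = 0 := by
      rcases smul_eq_zero.mp hψ0 with h | h
      · exact absurd h (by positivity)
      · exact h
    rw [h2]
    simp
  have hconst : Real.circleAverage (fun z => 1 / r ^ 4 + ‖b‖ ^ 2 + (ψ z).re) 0 r =
      1 / r ^ 4 + ‖b‖ ^ 2 := by
    have := Real.circleAverage_add (f₁ := fun _ : ℂ => 1 / r ^ 4 + ‖b‖ ^ 2)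
      (f₂ := fun z => (ψ z).re) (c := 0) (R := r) (circleIntegrable_const _ _ _)
      ⟨Complex.reCLM.integrable_comp hψi.1, Complex.reCLM.integrable_comp hψi.2⟩
    rw [hre, Real.circleAverage_const, add_zero] at this
    exact this
  rw [← hconst]
  apply Real.circleAverage_mono
  · apply ContinuousOn.circleIntegrable'
    refine continuousOn_const.add (continuous_re.comp_continuousOn ?_)
    rw [abs_of_pos hr]
    refine hψd.continuousOn.mono ?_
    rw [abs_of_pos hr, closure_ball _ hr.ne']
    exact sphere_subset_closedBall
  · apply ContinuousOn.circleIntegrable'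
    have := hl.continuousOn.mono hsph
    refine ContinuousOn.pow (ContinuousOn.norm (ContinuousOn.add (ContinuousOn.neg
      (ContinuousOn.inv₀ (by fun_prop) ?_)) this)) 2
    intro z hz
    rw [mem_sphere_zero_iff_norm, abs_of_pos hr] at hz
    have : z ≠ 0 := norm_pos_iff.mp (hz ▸ hr)
    positivity
  · intro z hz
    rw [mem_sphere_zero_iff_norm, abs_of_pos hr] at hz
    have hz0 : z ≠ 0 := norm_pos_iff.mp (hz ▸ hr)
    have hzz : conj z * z = (r : ℂ) ^ 2 := by
      rw [mul_comm, mul_conj, normSq_eq_norm_sq, hz]; push_cast; ring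
    have hr0 : (r : ℂ) ≠ 0 := by exact_mod_cast hr.ne'
    have hinv : (z ^ 2)⁻¹ = conj (z ^ 2 / r ^ 4) := by
      rw [map_div₀, map_pow, map_pow, conj_ofReal]
      field_simp
      rw [← mul_pow, mul_comm z, hzz]; ring
    set y : ℂ := z ^ 2 / r ^ 4 with hy
    have hyn : normSq y = 1 / r ^ 4 := by
      rw [hy, normSq_eq_norm_sq, norm_div, norm_pow, norm_pow, hz, norm_real, Real.norm_eq_abs,
        abs_of_pos hr]
      field_simp
    have hψz : ψ z = -2 * b * y + 2 * (conj b - y) * (l z - b) := by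
      simp only [hψ, hy]; ring
    rw [hinv, hψz, ← hyn, ← normSq_eq_norm_sq, ← normSq_eq_norm_sq]
    have : normSq (-(conj y) + l z) - (normSq y + normSq b +
        (-2 * b * y + 2 * (conj b - y) * (l z - b)).re) = normSq (l z - b) := by
      simp [normSq_apply]
      ring
    have := normSq_nonneg (l z - b)
    linarith

/-- Area estimate: if `P = G - b ε² conj G`, where `G = 1 / z + k z` is injective on the punctured
disk, is bounded by `T` on the circle of radius `ε`, then the area of the image under `P` of an
annulus outside this circle is at most that of a disk of radius `T`. -/
theorem area_annulus_le {k : ℂ → ℂ} (hk : DifferentiableOn ℂ k (ball 0 1))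
    (hinj : InjOn (fun z => z⁻¹ + k z) (ball 0 1 \ {0})) {ε ρ T : ℝ} (hε : 0 < ε) (hερ : ε ≤ ρ)
    (hρ : ρ < 1) (hb : ‖deriv k 0‖ * ε ^ 2 < 1) (hT : 0 ≤ T)
    (hP : ∀ ζ : ℂ, ‖ζ‖ = ε →
      ‖ζ⁻¹ + k ζ + conj (-(conj (deriv k 0) * ε ^ 2) * (ζ⁻¹ + k ζ))‖ ≤ T) :
    (1 - ‖deriv k 0‖ ^ 2 * ε ^ 4) *
      ((1 / ε ^ 2 - 1 / ρ ^ 2) + ‖deriv k 0‖ ^ 2 * (ρ ^ 2 - ε ^ 2)) ≤ T ^ 2 := by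
  set b := deriv k 0 with hbdef
  set G : ℂ → ℂ := fun z => z⁻¹ + k z with hG
  set P : ℂ → ℂ := fun z => G z + conj (-(conj b * ε ^ 2) * G z) with hPdef
  set A : Set ℂ := {z : ℂ | ‖z‖ ∈ Icc ε ρ} with hA
  have hAmeas : MeasurableSet A := measurableSet_Icc.preimage measurable_norm
  have hAne : ∀ z ∈ A, z ≠ 0 := fun z hz => norm_pos_iff.mp (hε.trans_le hz.1)
  have hAball : ∀ z ∈ A, z ∈ ball (0 : ℂ) 1 := fun z hz => by simpa using hz.2.trans_lt hρ
  have hκ : 0 < 1 - ‖b‖ ^ 2 * ε ^ 4 := by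
    have : (‖b‖ * ε ^ 2) ^ 2 < 1 := by
      apply pow_lt_one₀ (by positivity) hb two_ne_zero
    nlinarith
  have hGd : ∀ z ∈ A, HasDerivAt G (-(z ^ 2)⁻¹ + deriv k z) z := fun z hz =>
    (hasDerivAt_inv (hAne z hz)).add
      (hk.differentiableAt (isOpen_ball.mem_nhds (hAball z hz))).hasDerivAt
  have hder : ∀ z ∈ A, ∃ L : ℂ →L[ℝ] ℂ, HasFDerivAt P L z ∧
      L.det = (1 - ‖b‖ ^ 2 * ε ^ 4) * ‖-(z ^ 2)⁻¹ + deriv k z‖ ^ 2 := by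
    intro z hz
    obtain ⟨L, hL, hdet⟩ := hasFDerivAt_add_conj (hGd z hz)
      ((hGd z hz).const_mul (-(conj b * ε ^ 2)))
    refine ⟨L, hL, hdet.trans ?_⟩
    rw [norm_mul, norm_neg, norm_mul, RCLike.norm_conj, norm_pow, norm_real, Real.norm_eq_abs,
      sq_abs]
    ring
  -- `choose` needs a total function; the value off `A` is an irrelevant `0`.
  have hder' : ∀ z, ∃ L : ℂ →L[ℝ] ℂ, z ∈ A → HasFDerivAt P L z ∧
      L.det = (1 - ‖b‖ ^ 2 * ε ^ 4) * ‖-(z ^ 2)⁻¹ + deriv k z‖ ^ 2 := by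
    intro z
    by_cases hz : z ∈ A
    · obtain ⟨L, hL⟩ := hder z hz
      exact ⟨L, fun _ => hL⟩
    · exact ⟨0, fun h => absurd h hz⟩
  choose L hL using hder'
  have hPinj : InjOn P A := by
    intro x hx y hy hxy
    refine hinj ⟨hAball x hx, hAne x hx⟩ ⟨hAball y hy, hAne y hy⟩ ?_
    have h1 : G x - G y = b * ε ^ 2 * conj (G x - G y) := by
      simp only [hPdef, map_mul, map_neg, conj_conj, map_pow, conj_ofReal] at hxy
      rw [map_sub]
      linear_combination hxy
    have h2 : ‖G x - G y‖ = ‖b‖ * ε ^ 2 * ‖G x - G y‖ := by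
      conv_lhs => rw [h1]
      rw [norm_mul, norm_mul, RCLike.norm_conj, norm_pow, norm_real, Real.norm_eq_abs, sq_abs]
    have h3 : ‖G x - G y‖ = 0 := by
      have : (1 - ‖b‖ * ε ^ 2) * ‖G x - G y‖ = 0 := by linarith
      exact (mul_eq_zero.mp this).resolve_left (by linarith)
    exact sub_eq_zero.mp (norm_eq_zero.mp h3)
  -- `P` is real-linear in `G`, so each `Re (β P)` is some `Re (α G)`, which the maximum principle
  -- bounds by its values on the inner circle. The choice of `β` turns `P z` into `|P z|`.
  have himg : P '' A ⊆ closedBall 0 T := by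
    rintro _ ⟨z, hz, rfl⟩
    rw [mem_closedBall_zero_iff]
    by_cases hz0 : P z = 0
    · simpa [hz0] using hT
    set β : ℂ := conj (P z) / ‖P z‖ with hβ
    have hβn : ‖β‖ = 1 := by
      rw [hβ, norm_div, RCLike.norm_conj, norm_real, norm_norm, div_self]
      exact norm_ne_zero_iff.mpr hz0
    have hkey : ∀ ζ, ((β - conj β * conj b * ε ^ 2) * G ζ).re = (β * P ζ).re := by
      intro ζ
      simp only [hPdef]
      generalize G ζ = x
      have h1 : ∀ y : ℂ, (β * (x + conj y)).re = (β * x + conj β * y).re := fun y => by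
        simp
        ring
      rw [h1]
      ring_nf
    have := re_mul_inv_add_le hk hinj hε (α := β - conj β * conj b * ε ^ 2) (M := T) (by
      intro ζ hζ
      refine (hkey ζ).trans_le ((re_le_norm _).trans ?_)
      rw [norm_mul, hβn, one_mul]
      exact hP ζ hζ) hz.1 (hz.2.trans_lt hρ)
    have h2 := (hkey z).symm.trans_le this
    have h3 : β * P z = (‖P z‖ : ℂ) := by
      rw [hβ, div_mul_eq_mul_div, mul_comm, mul_conj, normSq_eq_norm_sq]
      have : (‖P z‖ : ℂ) ≠ 0 := by simpa using hz0
      push_cast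
      field_simp
    rwa [h3, ofReal_re] at h2
  have hcont : ContinuousOn (fun z => ‖-(z ^ 2)⁻¹ + deriv k z‖ ^ 2) A := by
    have h1 : ContinuousOn (deriv k) A :=
      ((hk.deriv isOpen_ball).continuousOn).mono hAball
    refine ContinuousOn.pow (ContinuousOn.norm (ContinuousOn.add (ContinuousOn.neg
      (ContinuousOn.inv₀ (by fun_prop) ?_)) h1)) 2
    intro z hz
    exact pow_ne_zero 2 (hAne z hz)
  have hAc : IsCompact A := by
    refine (isCompact_closedBall (0 : ℂ) ρ).of_isClosed_subset
      (isClosed_Icc.preimage continuous_norm) fun z hz => ?_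
    simpa using hz.2
  have hintA := hcont.integrableOn_compact (μ := volume) hAc
  have hvol := lintegral_abs_det_fderiv_eq_addHaar_image volume hAmeas
    (fun z hz => (hL z hz).1.hasFDerivWithinAt) hPinj
  have hle : (1 - ‖b‖ ^ 2 * ε ^ 4) * ∫ z in A, ‖-(z ^ 2)⁻¹ + deriv k z‖ ^ 2 ≤
      Real.pi * T ^ 2 := by
    rw [← integral_const_mul]
    have h1 : ENNReal.ofReal (∫ z in A, (1 - ‖b‖ ^ 2 * ε ^ 4) * ‖-(z ^ 2)⁻¹ + deriv k z‖ ^ 2) =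
        volume (P '' A) := by
      rw [ofReal_integral_eq_lintegral_ofReal (hintA.const_mul _)
        (Eventually.of_forall fun z => by positivity), ← hvol]
      refine setLIntegral_congr_fun hAmeas fun z hz => ?_
      rw [(hL z hz).2, abs_of_nonneg (by positivity)]
    have h2 : volume (P '' A) ≤ ENNReal.ofReal (Real.pi * T ^ 2) := by
      refine (measure_mono himg).trans_eq ?_
      rw [Complex.volume_closedBall, mul_comm, ENNReal.ofReal_mul Real.pi_pos.le,
        ENNReal.ofReal_pow hT]
      congr 1
      rw [← NNReal.coe_real_pi, ENNReal.ofReal_coe_nnreal]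
    rw [← h1] at h2
    exact (ENNReal.ofReal_le_ofReal_iff (by positivity)).mp h2
  have hlow : Real.pi * ((1 / ε ^ 2 - 1 / ρ ^ 2) + ‖b‖ ^ 2 * (ρ ^ 2 - ε ^ 2)) ≤
      ∫ z in A, ‖-(z ^ 2)⁻¹ + deriv k z‖ ^ 2 := by
    obtain ⟨hci, heq⟩ := setIntegral_annulus_eq hε hερ hcont
    rw [heq]
    have hint : ∫ r in ε..ρ, r * (2 * Real.pi * (1 / r ^ 4 + ‖b‖ ^ 2)) =
        Real.pi * ((1 / ε ^ 2 - 1 / ρ ^ 2) + ‖b‖ ^ 2 * (ρ ^ 2 - ε ^ 2)) := by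
      have hd : ∀ r ∈ uIcc ε ρ, HasDerivAt (fun r : ℝ => Real.pi * (‖b‖ ^ 2 * r ^ 2 - (r ^ 2)⁻¹))
          (r * (2 * Real.pi * (1 / r ^ 4 + ‖b‖ ^ 2))) r := by
        intro r hr
        rw [uIcc_of_le hερ] at hr
        have hr0 : r ≠ 0 := (hε.trans_le hr.1).ne'
        have := (((hasDerivAt_pow 2 r).const_mul (‖b‖ ^ 2)).sub
          ((hasDerivAt_pow 2 r).inv (pow_ne_zero 2 hr0))).const_mul Real.pi
        refine this.congr_deriv ?_
        field_simp
        ring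
      rw [intervalIntegral.integral_eq_sub_of_hasDerivAt hd]
      · rw [one_div, one_div]; ring
      · apply ContinuousOn.intervalIntegrable
        intro r hr
        rw [uIcc_of_le hερ] at hr
        have hr0 : r ≠ 0 := (hε.trans_le hr.1).ne'
        apply ContinuousAt.continuousWithinAt
        fun_prop (disch := positivity)
    rw [← hint]
    apply intervalIntegral.integral_mono_on hερ
    · apply ContinuousOn.intervalIntegrable
      intro r hr
      rw [uIcc_of_le hερ] at hr
      have hr0 : r ≠ 0 := (hε.trans_le hr.1).ne'
      apply ContinuousAt.continuousWithinAt
      fun_prop (disch := positivity)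
    · exact hci
    · intro r hr
      have hr0 : 0 < r := hε.trans_le hr.1
      have := le_circleAverage_sq (hk.deriv isOpen_ball) hr0 (hr.2.trans_lt hρ)
      gcongr
  have h := (mul_le_mul_of_nonneg_left hlow hκ.le).trans hle
  refine le_of_mul_le_mul_left ?_ Real.pi_pos
  linarith

/-- **Area theorem**, first coefficient: if `1 / z + k z` is injective on the punctured unit disk
with `k` holomorphic and `k 0 = 0`, then `|k' 0| ≤ 1`. -/
theorem norm_deriv_le_one_of_injOn_inv_add {k : ℂ → ℂ} (hk : DifferentiableOn ℂ k (ball 0 1))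
    (hk0 : k 0 = 0) (hinj : InjOn (fun z => z⁻¹ + k z) (ball 0 1 \ {0})) :
    ‖deriv k 0‖ ≤ 1 := by
  set b := deriv k 0 with hb
  have hnh : ball (0 : ℂ) 1 ∈ 𝓝 0 := ball_mem_nhds 0 one_pos
  set s := dslope k 0 with hs
  have hsd : DifferentiableOn ℂ s (ball 0 1) := (differentiableOn_dslope hnh).mpr hk
  set t := dslope s 0 with ht
  have htd : DifferentiableOn ℂ t (ball 0 1) := (differentiableOn_dslope hnh).mpr hsd
  have hks : ∀ z, k z = z * s z := fun z => by
    have := sub_smul_dslope k 0 z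
    simpa [hk0] using this.symm
  have hst : ∀ z, s z = b + z * t z := fun z => by
    have := sub_smul_dslope s 0 z
    rw [sub_zero, smul_eq_mul, hs, dslope_same, ← hb, ← hs, ← ht] at this
    rw [this]
    ring
  have hsub : closedBall (0 : ℂ) (1 / 2) ⊆ ball 0 1 := closedBall_subset_ball (by norm_num)
  obtain ⟨C₁, hC₁⟩ := (isCompact_closedBall (0 : ℂ) (1 / 2)).exists_bound_of_continuousOn
    (hsd.continuousOn.mono hsub)
  obtain ⟨C₂, hC₂⟩ := (isCompact_closedBall (0 : ℂ) (1 / 2)).exists_bound_of_continuousOn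
    (htd.continuousOn.mono hsub)
  have hC₁0 : 0 ≤ C₁ := (norm_nonneg _).trans (hC₁ 0 (by simp))
  have hC₂0 : 0 ≤ C₂ := (norm_nonneg _).trans (hC₂ 0 (by simp))
  set C := C₂ + ‖b‖ * C₁ with hC
  have hC0 : 0 ≤ C := by positivity
  have hρ : ∀ ρ : ℝ, 0 < ρ → ρ < 1 → ‖b‖ ^ 2 * ρ ^ 2 - 1 / ρ ^ 2 ≤ 0 := by
    intro ρ hρ0 hρ1
    have hev : ∀ᶠ ε : ℝ in 𝓝[>] 0, (‖b‖ ^ 2 * (ρ ^ 2 - ε ^ 2) - 1 / ρ ^ 2) - ‖b‖ ^ 2 * ε ^ 2 -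
        ‖b‖ ^ 2 * ε ^ 4 * (‖b‖ ^ 2 * (ρ ^ 2 - ε ^ 2) - 1 / ρ ^ 2) ≤
          2 * C * ε + C ^ 2 * ε ^ 4 := by
      have h1 : ∀ᶠ ε : ℝ in 𝓝[>] 0, ε < ρ :=
        (eventually_lt_nhds hρ0).filter_mono nhdsWithin_le_nhds
      have h2 : ∀ᶠ ε : ℝ in 𝓝[>] 0, ε < 1 / 2 :=
        (eventually_lt_nhds (by norm_num)).filter_mono nhdsWithin_le_nhds
      have h3 : ∀ᶠ ε : ℝ in 𝓝[>] 0, ‖b‖ * ε ^ 2 < 1 := by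
        have : Tendsto (fun ε : ℝ => ‖b‖ * ε ^ 2) (𝓝 0) (𝓝 0) := by
          have : Continuous fun ε : ℝ => ‖b‖ * ε ^ 2 := by fun_prop
          simpa using this.tendsto 0
        exact (this.eventually (eventually_lt_nhds one_pos)).filter_mono nhdsWithin_le_nhds
      filter_upwards [h1, h2, h3, self_mem_nhdsWithin] with ε h1 h2 h3 hε
      have hε : 0 < ε := hε
      -- On `|ζ| = ε` one has `ε² conj (ζ⁻¹) = ζ`, so subtracting `b ε² conj G` cancels the term `b
      -- ζ` and leaves `ζ⁻¹ + O(ε²)`. The squared radius then exceeds `1 / ε²` only by `O(ε)`.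
      -- Bounding `G` itself by `1 / ε + O(ε)` would leave an `O(1)` error, too much for the limit
      -- `ε → 0`.
      have hT : (0 : ℝ) ≤ 1 / ε + C * ε ^ 2 := by positivity
      have := area_annulus_le hk hinj hε h1.le hρ1 h3 hT (by
        intro ζ hζ
        have hζ0 : ζ ≠ 0 := norm_pos_iff.mp (hζ ▸ hε)
        have hζm : ζ ∈ closedBall (0 : ℂ) (1 / 2) := by
          rw [mem_closedBall_zero_iff, hζ]; exact h2.le
        have hcc : (ε : ℂ) ^ 2 * conj (ζ⁻¹) = ζ := by
          have : conj ζ ≠ 0 := by simpa using hζ0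
          rw [map_inv₀]
          field_simp
          rw [mul_comm, mul_conj, normSq_eq_norm_sq, hζ]
          push_cast
          ring
        have e : ζ⁻¹ + k ζ + conj (-(conj b * ε ^ 2) * (ζ⁻¹ + k ζ)) =
            ζ⁻¹ + (ζ ^ 2 * t ζ - b * ε ^ 2 * conj (ζ * s ζ)) := by
          have h4 : k ζ = b * ζ + ζ ^ 2 * t ζ := by rw [hks, hst]; ring
          rw [← hks, map_mul, map_neg, map_mul, conj_conj, map_pow, conj_ofReal, map_add]
          linear_combination h4 - b * hcc
        rw [← hb, e]
        refine (norm_add_le _ _).trans ?_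
        rw [norm_inv, hζ, one_div]
        gcongr
        refine (norm_sub_le _ _).trans ?_
        have e1 : ‖ζ ^ 2 * t ζ‖ ≤ ε ^ 2 * C₂ := by
          rw [norm_mul, norm_pow, hζ]
          gcongr
          exact hC₂ ζ hζm
        have e2 : ‖b * ε ^ 2 * conj (ζ * s ζ)‖ ≤ ‖b‖ * ε ^ 2 * (ε * C₁) := by
          rw [norm_mul, norm_mul, RCLike.norm_conj, norm_mul, hζ, norm_pow, norm_real,
            Real.norm_eq_abs, sq_abs]
          gcongr
          exact hC₁ ζ hζm
        have e3 : ‖b‖ * ε ^ 2 * (ε * C₁) ≤ ‖b‖ * ε ^ 2 * (1 * C₁) := by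
          gcongr
          linarith
        rw [hC]
        linarith)
      have e1 : (1 / ε + C * ε ^ 2) ^ 2 = 1 / ε ^ 2 + (2 * C * ε + C ^ 2 * ε ^ 4) := by
        field_simp
        ring
      have e2 : ε ^ 4 * (1 / ε ^ 2) = ε ^ 2 := by
        field_simp
      rw [e1, ← hb] at this
      linear_combination this + ‖b‖ ^ 2 * e2
    have hl : Tendsto (fun ε : ℝ => (‖b‖ ^ 2 * (ρ ^ 2 - ε ^ 2) - 1 / ρ ^ 2) - ‖b‖ ^ 2 * ε ^ 2 -
        ‖b‖ ^ 2 * ε ^ 4 * (‖b‖ ^ 2 * (ρ ^ 2 - ε ^ 2) - 1 / ρ ^ 2)) (𝓝[>] 0)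
        (𝓝 (‖b‖ ^ 2 * ρ ^ 2 - 1 / ρ ^ 2)) := by
      have : Continuous fun ε : ℝ => (‖b‖ ^ 2 * (ρ ^ 2 - ε ^ 2) - 1 / ρ ^ 2) - ‖b‖ ^ 2 * ε ^ 2 -
        ‖b‖ ^ 2 * ε ^ 4 * (‖b‖ ^ 2 * (ρ ^ 2 - ε ^ 2) - 1 / ρ ^ 2) := by fun_prop
      simpa using (this.tendsto 0).mono_left (nhdsWithin_le_nhds (s := Ioi 0))
    have hr : Tendsto (fun ε : ℝ => 2 * C * ε + C ^ 2 * ε ^ 4) (𝓝[>] 0) (𝓝 0) := by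
      have : Continuous fun ε : ℝ => 2 * C * ε + C ^ 2 * ε ^ 4 := by fun_prop
      simpa using (this.tendsto 0).mono_left (nhdsWithin_le_nhds (s := Ioi 0))
    exact le_of_tendsto_of_tendsto hl hr hev
  have hlim : ‖b‖ ^ 2 * 1 ^ 2 - 1 / 1 ^ 2 ≤ 0 := by
    have hc : Tendsto (fun ρ : ℝ => ‖b‖ ^ 2 * ρ ^ 2 - 1 / ρ ^ 2) (𝓝[<] 1)
        (𝓝 (‖b‖ ^ 2 * 1 ^ 2 - 1 / 1 ^ 2)) := by
      have : ContinuousAt (fun ρ : ℝ => ‖b‖ ^ 2 * ρ ^ 2 - 1 / ρ ^ 2) 1 := by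
        fun_prop (disch := norm_num)
      exact this.tendsto.mono_left nhdsWithin_le_nhds
    refine le_of_tendsto hc ?_
    filter_upwards [self_mem_nhdsWithin,
      (eventually_gt_nhds (zero_lt_one' ℝ)).filter_mono nhdsWithin_le_nhds] with ρ h1 h2
    exact hρ ρ h2 h1
  norm_num at hlim
  exact hlim

/-! ### Bieberbach's inequality -/

/-- A nonvanishing holomorphic function on a disk has a holomorphic logarithm. -/
theorem exists_hasDerivAt_log {p : ℂ → ℂ} {r : ℝ} (hr : 0 < r)
    (hp : DifferentiableOn ℂ p (ball 0 r)) (hne : ∀ z ∈ ball (0 : ℂ) r, p z ≠ 0) (hp0 : p 0 = 1) :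
    ∃ F : ℂ → ℂ, F 0 = 0 ∧ (∀ z ∈ ball (0 : ℂ) r, HasDerivAt F (deriv p z / p z) z) ∧
      ∀ z ∈ ball (0 : ℂ) r, exp (F z) = p z := by
  have hq : DifferentiableOn ℂ (fun z => deriv p z / p z) (ball 0 r) :=
    (hp.deriv isOpen_ball).div hp hne
  obtain ⟨F, hF0, hF⟩ := hq.isExactOn_ball.with_val_at 0 0
  refine ⟨F, hF0, hF, fun z hz => ?_⟩
  have hder : ∀ z ∈ ball (0 : ℂ) r, HasDerivAt (fun z => p z * exp (-F z)) 0 z := by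
    intro z hz
    have h1 := (hp.differentiableAt (isOpen_ball.mem_nhds hz)).hasDerivAt
    refine (h1.mul (hF z hz).neg.cexp).congr_deriv ?_
    have := hne z hz
    field_simp
    ring
  have hconst := (convex_ball (0 : ℂ) r).is_const_of_fderivWithin_eq_zero (𝕜 := ℂ)
    (fun z hz => (hder z hz).differentiableAt.differentiableWithinAt) (fun z hz => by
      rw [fderivWithin_of_isOpen isOpen_ball hz]
      ext
      simp [(hder z hz).deriv]) hz (mem_ball_self hr)
  simp only [hF0, hp0, neg_zero, exp_zero, mul_one] at hconst
  rw [exp_neg] at hconst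
  field_simp [exp_ne_zero] at hconst
  exact hconst.symm

/-- **Bieberbach's inequality** for the second coefficient of a normalized injective holomorphic
function on the unit disk. -/
theorem norm_deriv_deriv_le_four {h : ℂ → ℂ} (hd : DifferentiableOn ℂ h (ball 0 1))
    (hinj : InjOn h (ball 0 1)) (h0 : h 0 = 0) (h1 : deriv h 0 = 1) :
    ‖deriv (deriv h) 0‖ ≤ 4 := by
  have hnh : ball (0 : ℂ) 1 ∈ 𝓝 0 := ball_mem_nhds 0 one_pos
  set p := dslope h 0 with hp
  have hpd : DifferentiableOn ℂ p (ball 0 1) := (differentiableOn_dslope hnh).mpr hd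
  have hp0 : p 0 = 1 := by rw [hp, dslope_same, h1]
  have hhp : ∀ z, h z = z * p z := fun z => by
    have := sub_smul_dslope h 0 z
    simpa [h0] using this.symm
  have hne : ∀ z ∈ ball (0 : ℂ) 1, p z ≠ 0 := by
    intro z hz hpz
    have : z = 0 := hinj hz (mem_ball_self one_pos) (by rw [h0, hhp, hpz, mul_zero])
    rw [this, hp0] at hpz
    exact one_ne_zero hpz
  have hp' : deriv (deriv h) 0 = 2 * deriv p 0 := by
    have hev : deriv h =ᶠ[𝓝 0] fun z => p z + z * deriv p z := by
      filter_upwards [hnh] with z hz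
      have := (hasDerivAt_id z).mul
        (hpd.differentiableAt (isOpen_ball.mem_nhds hz)).hasDerivAt
      have h2 : HasDerivAt h (1 * p z + z * deriv p z) z := by
        refine this.congr_of_eventuallyEq (Eventually.of_forall fun x => ?_)
        simp [hhp x]
      rw [h2.deriv, one_mul]
    rw [hev.deriv_eq]
    have h3 := (hpd.differentiableAt hnh).hasDerivAt
    have h4 := ((hpd.deriv isOpen_ball).differentiableAt hnh).hasDerivAt
    have := (h3.add ((hasDerivAt_id (0 : ℂ)).mul h4)).deriv
    rw [show (fun z => p z + z * deriv p z) = p + id * deriv p from rfl, this]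
    simp
    ring
  obtain ⟨F, hF0, hF, hexp⟩ := exists_hasDerivAt_log one_pos hpd hne hp0
  -- A branch of `p ^ (-1/2)`, so that `s (z²) / z` is the odd function `1 / √(h (z²))`. Its
  -- coefficient of `z` is `-p' 0 / 2 = -h'' 0 / 4`.
  set s : ℂ → ℂ := fun z => exp (-F z / 2) with hs
  have hsd' : ∀ z ∈ ball (0 : ℂ) 1, HasDerivAt s (s z * (-(deriv p z / p z) / 2)) z :=
    fun z hz => ((hF z hz).neg.div_const 2).cexp
  have hsd : DifferentiableOn ℂ s (ball 0 1) := fun z hz =>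
    (hsd' z hz).differentiableAt.differentiableWithinAt
  have hs0 : s 0 = 1 := by simp [hs, hF0]
  have hsp : ∀ z ∈ ball (0 : ℂ) 1, s z ^ 2 * p z = 1 := by
    intro z hz
    rw [← hexp z hz, hs, ← exp_nat_mul, ← exp_add]
    simp
    ring_nf
    simp
  set S := dslope s 0 with hS
  have hSd : DifferentiableOn ℂ S (ball 0 1) := (differentiableOn_dslope hnh).mpr hsd
  have hsS : ∀ z, s z = 1 + z * S z := fun z => by
    have := sub_smul_dslope s 0 z
    rw [sub_zero, smul_eq_mul, hs0] at this
    rw [this]; ring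
  have hS0 : S 0 = -deriv p 0 / 2 := by
    rw [hS, dslope_same, (hsd' 0 (mem_ball_self one_pos)).deriv, hs0, hp0]
    ring
  have hsq : MapsTo (fun z : ℂ => z ^ 2) (ball 0 1) (ball 0 1) := by
    intro z hz
    rw [mem_ball_zero_iff] at hz ⊢
    rw [norm_pow]
    exact pow_lt_one₀ (norm_nonneg _) hz two_ne_zero
  set k : ℂ → ℂ := fun z => z * S (z ^ 2) with hk
  have hkd : DifferentiableOn ℂ k (ball 0 1) :=
    differentiableOn_id.mul (hSd.comp (by fun_prop) hsq)
  have hG : ∀ z, z ≠ 0 → z⁻¹ + k z = s (z ^ 2) / z := by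
    intro z hz
    rw [hsS, hk]
    field_simp
  have hGinj : InjOn (fun z => z⁻¹ + k z) (ball 0 1 \ {0}) := by
    rintro x ⟨hx, hx0⟩ y ⟨hy, hy0⟩ hxy
    have hx0 : x ≠ 0 := hx0
    have hy0 : y ≠ 0 := hy0
    simp only [hG x hx0, hG y hy0] at hxy
    have hsx : s (x ^ 2) ≠ 0 := exp_ne_zero _
    have hx2 := hsp _ (hsq hx)
    have hy2 := hsp _ (hsq hy)
    simp only at hx2 hy2
    have hpx := hne _ (hsq hx)
    have hpy := hne _ (hsq hy)
    simp only at hpx hpy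
    have e : h (x ^ 2) = h (y ^ 2) := by
      have h3 : ∀ z : ℂ, z ≠ 0 → s (z ^ 2) ^ 2 * p (z ^ 2) = 1 →
          h (z ^ 2) = ((s (z ^ 2) / z) ^ 2)⁻¹ := by
        intro z hz hz2
        have hsz : s (z ^ 2) ≠ 0 := exp_ne_zero _
        rw [hhp]
        field_simp
        linear_combination hz2
      rw [h3 x hx0 hx2, h3 y hy0 hy2, hxy]
    have e2 : x ^ 2 = y ^ 2 := hinj (hsq hx) (hsq hy) e
    rcases sq_eq_sq_iff_eq_or_eq_neg.mp e2 with h4 | h4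
    · exact h4
    -- The case `x = -y` is excluded because `s (z²) / z` is odd and never zero.
    · exfalso
      rw [e2, h4] at hxy
      have hsy : s (y ^ 2) ≠ 0 := exp_ne_zero _
      rw [div_neg, neg_eq_iff_add_eq_zero, ← two_mul] at hxy
      simp [hsy, hy0] at hxy
  have hk' : deriv k 0 = -deriv p 0 / 2 := by
    have h5 : DifferentiableAt ℂ (fun z : ℂ => S (z ^ 2)) 0 :=
      (hSd.comp (by fun_prop) hsq).differentiableAt hnh
    have := ((hasDerivAt_id (0 : ℂ)).mul h5.hasDerivAt).deriv
    rw [show k = id * fun z => S (z ^ 2) from rfl, this]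
    simp [hS0]
  have := norm_deriv_le_one_of_injOn_inv_add hkd (by simp [hk]) hGinj
  rw [hk', norm_div, norm_neg, Complex.norm_ofNat] at this
  rw [hp', norm_mul, Complex.norm_ofNat]
  linarith

/-! ### Disk automorphisms, the pre-Schwarzian and Schwarz–Pick -/

/-- The automorphism of the unit disk that sends `0` to `a`. -/
noncomputable def diskAut (a z : ℂ) : ℂ := (z + a) / (1 + conj a * z)

theorem one_add_conj_mul_ne_zero {a z : ℂ} (ha : ‖a‖ < 1) (hz : ‖z‖ < 1) :
    1 + conj a * z ≠ 0 := by
  intro h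
  have h1 : ‖conj a * z‖ = 1 := by
    rw [← norm_neg, ← eq_neg_of_add_eq_zero_left h, norm_one]
  rw [norm_mul, RCLike.norm_conj] at h1
  nlinarith [norm_nonneg a, norm_nonneg z]

theorem norm_diskAut_lt_one {a z : ℂ} (ha : ‖a‖ < 1) (hz : ‖z‖ < 1) : ‖diskAut a z‖ < 1 := by
  have hne := one_add_conj_mul_ne_zero ha hz
  rw [diskAut, norm_div, div_lt_one (norm_pos_iff.mpr hne), ← sq_lt_sq₀ (norm_nonneg _)
    (norm_nonneg _), ← normSq_eq_norm_sq, ← normSq_eq_norm_sq]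
  have h1 : normSq (1 + conj a * z) - normSq (z + a) = (1 - normSq a) * (1 - normSq z) := by
    simp [normSq_apply]
    ring
  have h2 : 0 < (1 - normSq a) * (1 - normSq z) := by
    rw [normSq_eq_norm_sq, normSq_eq_norm_sq]
    have := norm_nonneg a
    have := norm_nonneg z
    apply mul_pos <;> nlinarith
  linarith

theorem mapsTo_diskAut {a : ℂ} (ha : ‖a‖ < 1) : MapsTo (diskAut a) (ball 0 1) (ball 0 1) :=
  fun z hz => by
    rw [mem_ball_zero_iff] at hz ⊢
    exact norm_diskAut_lt_one ha hz

theorem diskAut_zero (a : ℂ) : diskAut a 0 = a := by simp [diskAut]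

theorem hasDerivAt_diskAut {a z : ℂ} (hz : 1 + conj a * z ≠ 0) :
    HasDerivAt (diskAut a) ((1 - ‖a‖ ^ 2) / (1 + conj a * z) ^ 2) z := by
  have := ((hasDerivAt_id z).add_const a).div
    (((hasDerivAt_id z).const_mul (conj a)).const_add 1) hz
  refine this.congr_deriv ?_
  rw [← ofReal_pow, ← normSq_eq_norm_sq, ← mul_conj]
  simp
  ring

theorem injOn_diskAut {a : ℂ} (ha : ‖a‖ < 1) : InjOn (diskAut a) (ball 0 1) := by
  intro x hx y hy hxy
  rw [mem_ball_zero_iff] at hx hy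
  rw [diskAut, diskAut, div_eq_div_iff (one_add_conj_mul_ne_zero ha hx)
    (one_add_conj_mul_ne_zero ha hy)] at hxy
  have h1 : (x - y) * (1 - a * conj a) = 0 := by linear_combination hxy
  have h2 : 1 - a * conj a ≠ 0 := by
    rw [mul_conj, normSq_eq_norm_sq]
    norm_cast
    have := norm_nonneg a
    nlinarith
  exact sub_eq_zero.mp ((mul_eq_zero.mp h1).resolve_right h2)

theorem one_sub_norm_sq_ne_zero {a : ℂ} (ha : ‖a‖ < 1) : (1 - ‖a‖ ^ 2 : ℂ) ≠ 0 := by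
  norm_cast
  have := norm_nonneg a
  nlinarith

/-- The distortion inequality for the pre-Schwarzian of an injective holomorphic function. -/
theorem norm_preSchwarzian_sub_le {h : ℂ → ℂ} (hd : DifferentiableOn ℂ h (ball 0 1))
    (hinj : InjOn h (ball 0 1)) {a : ℂ} (ha : ‖a‖ < 1) :
    ‖(1 - ‖a‖ ^ 2) * (deriv (deriv h) a / deriv h a) - 2 * conj a‖ ≤ 4 := by
  have hnh : ball (0 : ℂ) 1 ∈ 𝓝 0 := ball_mem_nhds 0 one_pos
  have ham : a ∈ ball (0 : ℂ) 1 := by simpa using ha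
  have hda : deriv h a ≠ 0 := deriv_ne_zero_of_injOn isOpen_ball hd hinj ham
  have hna := one_sub_norm_sq_ne_zero ha
  set κ : ℂ := (1 - ‖a‖ ^ 2) * deriv h a with hκ
  have hκ0 : κ ≠ 0 := mul_ne_zero hna hda
  -- The Koebe transform of `h` at `a`: again univalent and normalized, with `H'' 0` equal to the
  -- quantity to be bounded.
  set H : ℂ → ℂ := fun z => (h (diskAut a z) - h a) / κ with hH
  have hder : ∀ z ∈ ball (0 : ℂ) 1, HasDerivAt H
      (deriv h (diskAut a z) / (1 + conj a * z) ^ 2 / deriv h a) z := by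
    intro z hz
    have hz' : ‖z‖ < 1 := by simpa using hz
    have hne := one_add_conj_mul_ne_zero ha hz'
    have h1 := (hd.differentiableAt (isOpen_ball.mem_nhds (mapsTo_diskAut ha hz))).hasDerivAt
    have := ((h1.comp z (hasDerivAt_diskAut hne)).sub_const (h a)).div_const κ
    refine this.congr_deriv ?_
    rw [hκ]
    field_simp
  have hHd : DifferentiableOn ℂ H (ball 0 1) := fun z hz =>
    (hder z hz).differentiableAt.differentiableWithinAt
  have hHinj : InjOn H (ball 0 1) := by
    intro x hx y hy hxy
    simp only [hH] at hxy
    rw [div_left_inj' hκ0, sub_left_inj] at hxy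
    exact injOn_diskAut ha hx hy (hinj (mapsTo_diskAut ha hx) (mapsTo_diskAut ha hy) hxy)
  have hH0 : H 0 = 0 := by simp [hH, diskAut_zero]
  have hH1 : deriv H 0 = 1 := by
    rw [(hder 0 (mem_ball_self one_pos)).deriv, diskAut_zero]
    simp [hda]
  have hev : deriv H =ᶠ[𝓝 0] fun z => deriv h (diskAut a z) / (1 + conj a * z) ^ 2 / deriv h a := by
    filter_upwards [hnh] with z hz
    exact (hder z hz).deriv
  have hH2 : deriv (deriv H) 0 =
      (1 - ‖a‖ ^ 2) * (deriv (deriv h) a / deriv h a) - 2 * conj a := by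
    rw [hev.deriv_eq]
    have h1 : HasDerivAt (deriv h) (deriv (deriv h) a) (diskAut a 0) := by
      rw [diskAut_zero]
      exact ((hd.deriv isOpen_ball).differentiableAt (isOpen_ball.mem_nhds ham)).hasDerivAt
    have h2 := h1.comp 0 (hasDerivAt_diskAut (a := a) (z := 0) (by simp))
    have h3 : HasDerivAt (fun z : ℂ => (1 + conj a * z) ^ 2) (2 * conj a) 0 := by
      have := (((hasDerivAt_id (0 : ℂ)).const_mul (conj a)).const_add 1).pow 2
      exact this.congr_deriv (by simp)
    have h4 := ((h2.div h3 (by simp)).div_const (deriv h a)).deriv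
    refine h4.trans ?_
    simp [diskAut_zero]
    field_simp
  rw [← hH2]
  exact norm_deriv_deriv_le_four hHd hHinj hH0 hH1

/-- The **Schwarz–Pick lemma** for the derivative. -/
theorem norm_deriv_mul_le_one_sub_sq {w : ℂ → ℂ} (hd : DifferentiableOn ℂ w (ball 0 1))
    (hw : ∀ z ∈ ball (0 : ℂ) 1, ‖w z‖ < 1) {a : ℂ} (ha : ‖a‖ < 1) :
    ‖deriv w a‖ * (1 - ‖a‖ ^ 2) ≤ 1 - ‖w a‖ ^ 2 := by
  have ham : a ∈ ball (0 : ℂ) 1 := by simpa using ha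
  have hc : ‖-w a‖ < 1 := by rw [norm_neg]; exact hw a ham
  set c := -w a with hcdef
  -- Composition with automorphisms on both sides moves `a` and `w a` to `0`, where the Schwarz
  -- lemma bounds the derivative by `1`.
  have hder : ∀ z ∈ ball (0 : ℂ) 1, HasDerivAt (fun z => diskAut c (w (diskAut a z)))
      ((1 - ‖c‖ ^ 2) / (1 + conj c * w (diskAut a z)) ^ 2 *
        (deriv w (diskAut a z) * ((1 - ‖a‖ ^ 2) / (1 + conj a * z) ^ 2))) z := by
    intro z hz
    have hz' : ‖z‖ < 1 := by simpa using hz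
    have hm := mapsTo_diskAut ha hz
    have h1 := (hd.differentiableAt (isOpen_ball.mem_nhds hm)).hasDerivAt
    have h2 := h1.comp z (hasDerivAt_diskAut (one_add_conj_mul_ne_zero ha hz'))
    exact (hasDerivAt_diskAut (one_add_conj_mul_ne_zero hc (hw _ hm))).comp z h2
  have h0 : diskAut c (w (diskAut a 0)) = 0 := by simp [diskAut, hcdef]
  have hle := norm_deriv_le_one_of_mapsTo_ball (c := (0 : ℂ)) (R := 1)
    (f := fun z => diskAut c (w (diskAut a z)))
    (fun z hz => (hder z hz).differentiableAt.differentiableWithinAt) (fun z hz => by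
      rw [h0, mem_closedBall_zero_iff]
      exact (norm_diskAut_lt_one hc (hw _ (mapsTo_diskAut ha hz))).le) one_pos
  rw [(hder 0 (mem_ball_self one_pos)).deriv, diskAut_zero] at hle
  have hcw : 1 + conj c * w a = ((1 - ‖c‖ ^ 2 : ℝ) : ℂ) := by
    have : w a = -c := by simp [hcdef]
    rw [this, mul_neg, mul_comm, mul_conj, normSq_eq_norm_sq]
    push_cast
    ring
  have hcp : 0 < 1 - ‖c‖ ^ 2 := by nlinarith [norm_nonneg c]
  have hap : 0 < 1 - ‖a‖ ^ 2 := by nlinarith [norm_nonneg a]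
  have hcn : ‖(1 - ‖c‖ ^ 2 : ℂ)‖ = 1 - ‖c‖ ^ 2 := by
    have : (1 - ‖c‖ ^ 2 : ℂ) = ((1 - ‖c‖ ^ 2 : ℝ) : ℂ) := by push_cast; ring
    rw [this, norm_real, Real.norm_eq_abs, abs_of_pos hcp]
  have han : ‖(1 - ‖a‖ ^ 2 : ℂ)‖ = 1 - ‖a‖ ^ 2 := by
    have : (1 - ‖a‖ ^ 2 : ℂ) = ((1 - ‖a‖ ^ 2 : ℝ) : ℂ) := by push_cast; ring
    rw [this, norm_real, Real.norm_eq_abs, abs_of_pos hap]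
  rw [hcw, norm_mul, norm_div, norm_pow, norm_real, Real.norm_eq_abs, abs_of_pos hcp, hcn, norm_mul,
    mul_zero, add_zero, one_pow, div_one, han] at hle
  have h3 : ‖c‖ = ‖w a‖ := by simp [hcdef]
  rw [← h3]
  have h4 : (1 - ‖c‖ ^ 2) / (1 - ‖c‖ ^ 2) ^ 2 * (‖deriv w a‖ * (1 - ‖a‖ ^ 2)) =
      ‖deriv w a‖ * (1 - ‖a‖ ^ 2) / (1 - ‖c‖ ^ 2) := by
    field_simp
  rwa [h4, div_le_one hcp] at hle

/-! ### Growth estimate and the bound on the dilatation -/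

/-- Growth of an injective holomorphic function against its derivative. -/
theorem norm_mul_le_norm_deriv_mul {h : ℂ → ℂ} (hd : DifferentiableOn ℂ h (ball 0 1))
    (hinj : InjOn h (ball 0 1)) (h0 : h 0 = 0) {z : ℂ} (hz : ‖z‖ < 1) :
    ‖h z‖ * (1 - ‖z‖) ≤ ‖deriv h z‖ * (‖z‖ * (1 + ‖z‖)) := by
  by_cases hz0 : z = 0
  · simp [hz0, h0]
  set r := ‖z‖ with hr
  have hr0 : 0 < r := norm_pos_iff.mpr hz0
  set e : ℂ := z / r with he
  have hrc : (r : ℂ) ≠ 0 := by exact_mod_cast hr0.ne'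
  have hze : (r : ℂ) * e = z := by rw [he]; field_simp
  have hen : ‖e‖ = 1 := by
    rw [he, norm_div, norm_real, Real.norm_eq_abs, abs_of_pos hr0, ← hr, div_self hr0.ne']
  have hmem : ∀ t ∈ Icc 0 r, (t : ℂ) * e ∈ ball (0 : ℂ) 1 := by
    intro t ht
    rw [mem_ball_zero_iff, norm_mul, hen, norm_real, Real.norm_eq_abs, abs_of_nonneg ht.1, mul_one]
    exact ht.2.trans_lt hz
  have hline : ∀ t : ℝ, HasDerivAt (fun t : ℝ => (t : ℂ) * e) e t := fun t => by
    simpa using (Complex.ofRealCLM.hasDerivAt (x := t)).mul_const e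
  set q : ℝ → ℂ := fun t => deriv h (t * e) with hq
  have hqd : ∀ t ∈ Icc 0 r, HasDerivAt q (deriv (deriv h) (t * e) * e) t := by
    intro t ht
    have h1 := ((hd.deriv isOpen_ball).differentiableAt
      (isOpen_ball.mem_nhds (hmem t ht))).hasDerivAt
    exact h1.comp t (hline t)
  -- The logarithmic derivative of `M` is `(4 - 2t) / (1 - t²)`, the negative of the pre-Schwarzian
  -- lower bound for that of `|h'|` along the radius. So `|h'| M` is nondecreasing there, and
  -- integrating `1 / M`, whose primitive is `t / (1 + t)²`, yields the growth estimate.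
  set M : ℝ → ℝ := fun t => (1 + t) ^ 3 / (1 - t) with hM
  have hMd : ∀ t ∈ Icc 0 r, HasDerivAt M (M t * ((4 - 2 * t) / (1 - t ^ 2))) t := by
    intro t ht
    have h1 : (1 - t) ≠ 0 := by linarith [ht.2]
    have h2 : (1 + t) ≠ 0 := by linarith [ht.1]
    have := (((hasDerivAt_id t).const_add 1).pow 3).div ((hasDerivAt_id t).const_sub 1) h1
    refine this.congr_deriv ?_
    have h3 : 1 - t ^ 2 = (1 - t) * (1 + t) := by ring
    rw [hM, h3]
    simp
    field_simp
    ring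
  have hMpos : ∀ t ∈ Icc 0 r, 0 < M t := by
    intro t ht
    have : 0 < 1 - t := by linarith [ht.2]
    have : 0 < 1 + t := by linarith [ht.1]
    positivity
  have hφd : ∀ t ∈ Icc 0 r, HasDerivAt (fun t => ‖q t‖ ^ 2 * M t ^ 2)
      (2 * inner ℝ (q t) (deriv (deriv h) (t * e) * e) * M t ^ 2 +
        ‖q t‖ ^ 2 * (2 * M t * (M t * ((4 - 2 * t) / (1 - t ^ 2))))) t := fun t ht => by
    refine ((hqd t ht).norm_sq.mul ((hMd t ht).pow 2)).congr_deriv ?_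
    simp
  have hmono : MonotoneOn (fun t => ‖q t‖ ^ 2 * M t ^ 2) (Icc 0 r) := by
    apply monotoneOn_of_deriv_nonneg (convex_Icc 0 r)
    · exact fun t ht => (hφd t ht).continuousAt.continuousWithinAt
    · exact fun t ht => (hφd t (interior_subset ht)).differentiableAt.differentiableWithinAt
    · intro t ht
      have ht := interior_subset ht
      rw [(hφd t ht).deriv]
      have hq0 : q t ≠ 0 := deriv_ne_zero_of_injOn isOpen_ball hd hinj (hmem t ht)
      set Q : ℂ := deriv (deriv h) (t * e) / deriv h (t * e) with hQ
      have hte : ‖(t : ℂ) * e‖ = t := by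
        rw [norm_mul, hen, norm_real, Real.norm_eq_abs, abs_of_nonneg ht.1, mul_one]
      have hk := norm_preSchwarzian_sub_le hd hinj (a := t * e) (by simpa using hmem t ht)
      rw [hte, ← hQ] at hk
      have h1 : -4 ≤ (e * ((1 - (t : ℂ) ^ 2) * Q - 2 * conj (t * e))).re := by
        have := (abs_le.mp (abs_re_le_norm (e * ((1 - (t : ℂ) ^ 2) * Q - 2 * conj (t * e))))).1
        rw [norm_mul, hen, one_mul] at this
        linarith
      have h2 : e * ((1 - (t : ℂ) ^ 2) * Q - 2 * conj (t * e)) =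
          ((1 - t ^ 2 : ℝ) : ℂ) * (e * Q) - ((2 * t : ℝ) : ℂ) := by
        have : e * conj e = 1 := by rw [mul_conj, normSq_eq_norm_sq, hen]; simp
        rw [map_mul, conj_ofReal]
        push_cast
        linear_combination -2 * (t : ℂ) * this
      rw [h2, sub_re, re_ofReal_mul, ofReal_re] at h1
      have hin : inner ℝ (q t) (deriv (deriv h) (t * e) * e) = ‖q t‖ ^ 2 * (e * Q).re := by
        rw [Complex.inner, ← normSq_eq_norm_sq, ← re_ofReal_mul, ← mul_conj]
        congr 1
        have : deriv (deriv h) (t * e) = q t * Q := by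
          rw [hQ]
          change _ = q t * (_ / q t)
          field_simp
        rw [this]
        ring
      rw [hin]
      have ht1 : 0 < 1 - t ^ 2 := by nlinarith [ht.1, ht.2]
      have h3 : 0 ≤ (e * Q).re + (4 - 2 * t) / (1 - t ^ 2) := by
        have : (e * Q).re + (4 - 2 * t) / (1 - t ^ 2) =
          ((1 - t ^ 2) * (e * Q).re + (4 - 2 * t)) / (1 - t ^ 2) := by field_simp
        rw [this]
        apply div_nonneg _ ht1.le
        linarith
      have h4 : 0 ≤ 2 * ‖q t‖ ^ 2 * M t ^ 2 * ((e * Q).re + (4 - 2 * t) / (1 - t ^ 2)) := by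
        positivity
      linarith
  have hr_mem : r ∈ Icc 0 r := ⟨hr0.le, le_rfl⟩
  have hqle : ∀ t ∈ Icc 0 r, ‖q t‖ ≤ ‖q r‖ * M r * ((1 - t) / (1 + t) ^ 3) := by
    intro t ht
    have h1 := hmono ht hr_mem ht.2
    simp only at h1
    rw [← mul_pow, ← mul_pow, sq_le_sq₀ (mul_nonneg (norm_nonneg _) (hMpos t ht).le)
      (mul_nonneg (norm_nonneg _) (hMpos r hr_mem).le)] at h1
    have h2 : (1 - t) / (1 + t) ^ 3 = (M t)⁻¹ := by rw [hM, inv_div]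
    rw [h2, ← div_eq_mul_inv, le_div_iff₀ (hMpos t ht)]
    exact h1
  have hBd : ∀ t ∈ Icc 0 r, HasDerivAt (fun t => ‖q r‖ * M r * (t / (1 + t) ^ 2))
      (‖q r‖ * M r * ((1 - t) / (1 + t) ^ 3)) t := by
    intro t ht
    have h2 : (1 + t) ≠ 0 := by linarith [ht.1]
    have := ((hasDerivAt_id t).div (((hasDerivAt_id t).const_add 1).pow 2)
      (pow_ne_zero 2 h2)).const_mul (‖q r‖ * M r)
    refine this.congr_deriv ?_
    congr 1
    simp
    field_simp
    ring
  have hhd : ∀ t ∈ Icc 0 r, HasDerivAt (fun t : ℝ => h (t * e)) (q t * e) t := fun t ht =>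
    ((hd.differentiableAt (isOpen_ball.mem_nhds (hmem t ht))).hasDerivAt).comp t (hline t)
  have hfin := image_norm_le_of_norm_deriv_right_le_deriv_boundary'
    (f := fun t : ℝ => h (t * e)) (f' := fun t => q t * e) (a := 0) (b := r)
    (fun t ht => (hhd t ht).continuousAt.continuousWithinAt)
    (fun t ht => (hhd t (Ico_subset_Icc_self ht)).hasDerivWithinAt)
    (B := fun t => ‖q r‖ * M r * (t / (1 + t) ^ 2)) (by simp [h0])
    (fun t ht => (hBd t ht).continuousAt.continuousWithinAt)
    (fun t ht => (hBd t (Ico_subset_Icc_self ht)).hasDerivWithinAt)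
    (fun t ht => by
      rw [norm_mul, hen, mul_one]
      exact hqle t (Ico_subset_Icc_self ht)) hr_mem
  simp only [hq, hM, hze] at hfin
  have h1r : 0 < 1 - r := by linarith
  have h3 : ‖deriv h z‖ * ((1 + r) ^ 3 / (1 - r)) * (r / (1 + r) ^ 2) =
      ‖deriv h z‖ * (r * (1 + r)) / (1 - r) := by
    field_simp
  rwa [h3, le_div_iff₀ h1r] at hfin

/-- A bounded holomorphic function that is not a unimodular constant is smaller than one. -/
theorem IsBoundedByOne.norm_lt {w : ℂ → ℂ} (hw : IsBoundedByOne w)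
    (hc : ¬ IsUnimodularConstant w) {z : ℂ} (hz : z ∈ disk 1) : ‖w z‖ < 1 := by
  by_contra! hge
  have h1 : ‖w z‖ = 1 := le_antisymm (hw.norm_le z hz) hge
  refine hc ⟨w z, h1, fun x hx => ?_⟩
  exact eqOn_of_isPreconnected_of_isMaxOn_norm (convex_ball (0 : ℂ) 1).isPreconnected isOpen_ball
    hw.holo hz (fun y hy => by
      simp only [Function.comp_apply, mem_ofPred_eq, h1]
      exact hw.norm_le y hy) hx

/-- Below the radius `2 - √3` one has `4 r < 1 + r²`. -/
theorem four_mul_lt_of_lt {r : ℝ} (hr : r < 2 - Real.sqrt 3) : 4 * r < 1 + r ^ 2 := by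
  have h3 : Real.sqrt 3 ^ 2 = 3 := Real.sq_sqrt (by norm_num)
  have := Real.sqrt_nonneg 3
  nlinarith

theorem two_sub_sqrt_three_lt_one : 2 - Real.sqrt 3 < 1 := by
  have : (1 : ℝ) < Real.sqrt 3 := by
    rw [Real.lt_sqrt (by norm_num)]
    norm_num
  linarith

/-- The dilatation of a multiplier mapping is smaller than one in the disk of radius `2 - √3`. -/
theorem IsMultiplierMapping.norm_deriv_lt {f h g w : ℂ → ℂ} (hf : IsMultiplierMapping f h g w)
    {z : ℂ} (hz : z ∈ disk (2 - Real.sqrt 3)) : ‖deriv g z‖ < ‖deriv h z‖ := by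
  have hzr : ‖z‖ < 2 - Real.sqrt 3 := by simpa [disk] using hz
  have hz1 : ‖z‖ < 1 := hzr.trans two_sub_sqrt_three_lt_one
  have hzm : z ∈ disk 1 := by simpa [disk] using hz1
  have hnh : disk 1 ∈ 𝓝 z := isOpen_ball.mem_nhds hzm
  have hg' : deriv g z = deriv w z * h z + w z * deriv h z := by
    have hev : g =ᶠ[𝓝 z] fun z => w z * h z := eventually_of_mem hnh hf.g_eq
    rw [hev.deriv_eq]
    exact (((hf.bounded_w.holo.differentiableAt hnh).hasDerivAt).mul
      ((hf.normalized.holo_h.differentiableAt hnh).hasDerivAt)).deriv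
  have hgrow := norm_mul_le_norm_deriv_mul hf.normalized.holo_h hf.injOn_h hf.normalized.h_zero hz1
  have hw1 := hf.bounded_w.norm_lt hf.not_unimodular hzm
  have hsp := norm_deriv_mul_le_one_sub_sq hf.bounded_w.holo
    (fun z hz => hf.bounded_w.norm_lt hf.not_unimodular hz) hz1
  have hh0 : 0 < ‖deriv h z‖ :=
    norm_pos_iff.mpr (deriv_ne_zero_of_injOn isOpen_ball hf.normalized.holo_h hf.injOn_h hzm)
  have h4 := four_mul_lt_of_lt hzr
  set r := ‖z‖ with hr
  have hr0 : 0 ≤ r := norm_nonneg z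
  have hr1 : 0 < 1 - r := by linarith
  set x := ‖w z‖ with hx
  have hx0 : 0 ≤ x := norm_nonneg _
  have hprod : ‖deriv w z‖ * ‖h z‖ * (1 - r) ^ 2 ≤ ‖deriv h z‖ * ((1 - x ^ 2) * r) := by
    have h1 := mul_le_mul hsp hgrow (by positivity) (by nlinarith)
    have h2 : (1 + r) * (‖deriv w z‖ * ‖h z‖ * (1 - r) ^ 2) ≤
        (1 + r) * (‖deriv h z‖ * ((1 - x ^ 2) * r)) := by linarith
    exact le_of_mul_le_mul_left h2 (by linarith)
  have hlt : ‖deriv w z‖ * ‖h z‖ < ‖deriv h z‖ * (1 - x) := by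
    have h1 : ‖deriv h z‖ * ((1 - x ^ 2) * r) < ‖deriv h z‖ * (1 - x) * (1 - r) ^ 2 := by
      rw [mul_assoc]
      apply mul_lt_mul_of_pos_left _ hh0
      -- From `x < 1` and `2 r < (1 - r)²`, the latter being `4 r < 1 + r²`.
      have : (1 + x) * r < (1 - r) ^ 2 := by nlinarith
      nlinarith
    exact lt_of_mul_lt_mul_right (hprod.trans_lt h1) (by positivity)
  calc ‖deriv g z‖ ≤ ‖deriv w z‖ * ‖h z‖ + x * ‖deriv h z‖ := by
        rw [hg']
        refine (norm_add_le _ _).trans ?_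
        rw [norm_mul, norm_mul]
    _ < ‖deriv h z‖ := by linarith

/-! ### Radius of convexity -/

/-- An injective holomorphic function on an open set maps neighbourhoods to neighbourhoods. -/
theorem map_nhds_eq_of_injOn {h : ℂ → ℂ} {U : Set ℂ} (hU : IsOpen U)
    (hd : DifferentiableOn ℂ h U) (hinj : InjOn h U) {z : ℂ} (hz : z ∈ U) :
    map h (𝓝 z) = 𝓝 (h z) :=
  ((hd.analyticAt (hU.mem_nhds hz)).hasStrictDerivAt).map_nhds_eq
    (deriv_ne_zero_of_injOn hU hd hinj hz)

/-- The image of an open subset under an injective holomorphic function is open. -/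
theorem isOpen_image_of_injOn {h : ℂ → ℂ} {U V : Set ℂ} (hU : IsOpen U)
    (hd : DifferentiableOn ℂ h U) (hinj : InjOn h U) (hV : IsOpen V) (hVU : V ⊆ U) :
    IsOpen (h '' V) := by
  rw [isOpen_iff_mem_nhds]
  rintro _ ⟨z, hz, rfl⟩
  rw [← map_nhds_eq_of_injOn hU hd hinj (hVU hz)]
  exact image_mem_map (hV.mem_nhds hz)

/-- The inverse of an injective holomorphic function is holomorphic. -/
theorem hasDerivAt_invFunOn {h : ℂ → ℂ} {U : Set ℂ} (hU : IsOpen U)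
    (hd : DifferentiableOn ℂ h U) (hinj : InjOn h U) {z : ℂ} (hz : z ∈ U) :
    HasDerivAt (Function.invFunOn h U) (deriv h z)⁻¹ (h z) := by
  refine (HasStrictDerivAt.to_local_left_inverse
    ((hd.analyticAt (hU.mem_nhds hz)).hasStrictDerivAt)
    (deriv_ne_zero_of_injOn hU hd hinj hz) ?_).hasDerivAt
  filter_upwards [hU.mem_nhds hz] with x hx
  exact hinj.leftInvOn_invFunOn hx

/-- The analytic convexity condition for an injective function in the disk of radius `2 - √3`. -/
theorem one_add_re_preSchwarzian_pos {h : ℂ → ℂ} (hd : DifferentiableOn ℂ h (ball 0 1))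
    (hinj : InjOn h (ball 0 1)) {z : ℂ} (hz : ‖z‖ < 2 - Real.sqrt 3) :
    0 < 1 + (z * (deriv (deriv h) z / deriv h z)).re := by
  have hz1 := hz.trans two_sub_sqrt_three_lt_one
  have hk := norm_preSchwarzian_sub_le hd hinj hz1
  have h4 := four_mul_lt_of_lt hz
  set S := deriv (deriv h) z / deriv h z
  have h1 : -(4 * ‖z‖) ≤ (z * ((1 - (‖z‖ : ℂ) ^ 2) * S - 2 * conj z)).re := by
    have h5 := (abs_le.mp (abs_re_le_norm (z * ((1 - (‖z‖ : ℂ) ^ 2) * S - 2 * conj z)))).1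
    rw [norm_mul] at h5
    have := mul_le_mul_of_nonneg_left hk (norm_nonneg z)
    linarith
  have h2 : z * ((1 - (‖z‖ : ℂ) ^ 2) * S - 2 * conj z) =
      ((1 - ‖z‖ ^ 2 : ℝ) : ℂ) * (z * S) - ((2 * ‖z‖ ^ 2 : ℝ) : ℂ) := by
    have := mul_conj z
    rw [normSq_eq_norm_sq] at this
    push_cast at this ⊢
    linear_combination -2 * this
  rw [h2, sub_re, re_ofReal_mul, ofReal_re] at h1
  have h3 : 0 < 1 - ‖z‖ ^ 2 := by nlinarith [norm_nonneg z]
  -- Multiplied out, the product is at least `1 - 4 |z| + |z|²`.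
  have h5 : 0 < (1 - ‖z‖ ^ 2) * (1 + (z * S).re) := by linarith
  exact pos_of_mul_pos_right h5 h3.le

/-- If the segment between `h a` and `h c` lies in the image of the disk of radius `2 - √3`, then
the modulus of the preimages of its points is largest at an end point. -/
theorem norm_invFunOn_segment_le {h : ℂ → ℂ} (hd : DifferentiableOn ℂ h (ball 0 1))
    (hinj : InjOn h (ball 0 1)) {a c : ℂ} (ha : ‖a‖ < 1) (hc : ‖c‖ < 1)
    (hseg : ∀ t ∈ Icc (0 : ℝ) 1, h a + t * (h c - h a) ∈ h '' ball 0 (2 - Real.sqrt 3))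
    {t : ℝ} (ht : t ∈ Icc (0 : ℝ) 1) :
    ‖Function.invFunOn h (ball 0 1) (h a + t * (h c - h a))‖ ≤ max ‖a‖ ‖c‖ := by
  have hsub : ball (0 : ℂ) (2 - Real.sqrt 3) ⊆ ball 0 1 :=
    ball_subset_ball two_sub_sqrt_three_lt_one.le
  set k := Function.invFunOn h (ball 0 1) with hk
  set d := h c - h a with hdd
  set y : ℝ → ℂ := fun t => h a + t * d with hy
  have hkh : ∀ x ∈ ball (0 : ℂ) 1, k (h x) = x := fun x hx => hinj.leftInvOn_invFunOn hx
  have ham : a ∈ ball (0 : ℂ) 1 := by simpa using ha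
  have hcm : c ∈ ball (0 : ℂ) 1 := by simpa using hc
  have hy0 : k (y 0) = a := by simp [hy, hkh a ham]
  have hy1 : k (y 1) = c := by simp [hy, hdd, hkh c hcm]
  by_cases hd0 : d = 0
  · have : k (h a + t * d) = a := by rw [hd0, mul_zero, add_zero, hkh a ham]
    rw [this]
    exact le_max_left _ _
  set γ : ℝ → ℂ := fun t => k (y t) with hγ
  set V : Set ℝ := y ⁻¹' (h '' ball 0 (2 - Real.sqrt 3)) with hV
  have hyc : Continuous y := by simp only [hy]; fun_prop
  have hVo : IsOpen V :=
    (isOpen_image_of_injOn isOpen_ball hd hinj isOpen_ball hsub).preimage hyc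
  have hγV : ∀ t ∈ V, γ t ∈ ball (0 : ℂ) (2 - Real.sqrt 3) ∧ h (γ t) = y t := by
    rintro t ⟨x, hx, hxy⟩
    have : γ t = x := by simp only [hγ]; rw [← hxy, hkh x (hsub hx)]
    rw [this]
    exact ⟨hx, hxy⟩
  have hyd : ∀ t : ℝ, HasDerivAt y d t := fun t =>
    (((Complex.ofRealCLM.hasDerivAt (x := t)).mul_const d).const_add (h a)).congr_deriv (by simp)
  have hγd : ∀ t ∈ V, HasDerivAt γ ((deriv h (γ t))⁻¹ * d) t := by
    intro t ht
    obtain ⟨h1, h2⟩ := hγV t ht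
    have h3 := hasDerivAt_invFunOn isOpen_ball hd hinj (hsub h1)
    rw [h2] at h3
    exact h3.comp t (hyd t)
  set γ₁ : ℝ → ℂ := fun t => (deriv h (γ t))⁻¹ * d with hγ₁
  have hne : ∀ t ∈ V, deriv h (γ t) ≠ 0 := fun t ht =>
    deriv_ne_zero_of_injOn isOpen_ball hd hinj (hsub (hγV t ht).1)
  have hγ₁d : ∀ t ∈ V, HasDerivAt γ₁
      (-(γ₁ t) ^ 2 * (deriv (deriv h) (γ t) / deriv h (γ t))) t := by
    intro t ht
    have h1 := ((hd.deriv isOpen_ball).differentiableAt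
      (isOpen_ball.mem_nhds (hsub (hγV t ht).1))).hasDerivAt
    have h2 : HasDerivAt (fun t => deriv h (γ t)) (deriv (deriv h) (γ t) * γ₁ t) t :=
      h1.comp t (hγd t ht)
    refine ((h2.inv (hne t ht)).mul_const d).congr_deriv ?_
    have := hne t ht
    simp only [hγ₁]
    field_simp
  -- At an interior critical point `conj γ * γ'` is purely imaginary, which turns `u''` into `2
  -- |γ'|² (1 + Re (γ h'' / h'))`. This is positive by the convexity condition, so no maximum can
  -- occur there.
  set u : ℝ → ℝ := fun t => ‖γ t‖ ^ 2 with hu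
  have hud : ∀ t ∈ V, HasDerivAt u (2 * inner ℝ (γ t) (γ₁ t)) t := fun t ht =>
    (hγd t ht).norm_sq
  have hudd : ∀ t ∈ V, HasDerivAt (deriv u) (2 * (inner ℝ (γ t)
      (-(γ₁ t) ^ 2 * (deriv (deriv h) (γ t) / deriv h (γ t))) + inner ℝ (γ₁ t) (γ₁ t))) t := by
    intro t ht
    refine HasDerivAt.congr_of_eventuallyEq
      (((hγd t ht).inner ℝ (hγ₁d t ht)).const_mul 2) ?_
    filter_upwards [hVo.mem_nhds ht] with s hs
    exact (hud s hs).deriv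
  obtain ⟨t₀, ht₀, hmax⟩ := isCompact_Icc.exists_isMaxOn (⟨0, by simp⟩ : (Icc (0 : ℝ) 1).Nonempty)
    (f := u) fun t ht => (hud t (hseg t ht)).continuousAt.continuousWithinAt
  have hend : t₀ = 0 ∨ t₀ = 1 := by
    by_contra! hcon
    have ht₀' : t₀ ∈ Ioo (0 : ℝ) 1 :=
      ⟨lt_of_le_of_ne ht₀.1 hcon.1.symm, lt_of_le_of_ne ht₀.2 hcon.2⟩
    have hV₀ : t₀ ∈ V := hseg t₀ ht₀
    have hloc : IsLocalMax u t₀ := hmax.isLocalMax (Icc_mem_nhds ht₀'.1 ht₀'.2)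
    have hder0 := hloc.deriv_eq_zero
    have hin0 : (conj (γ t₀) * γ₁ t₀).re = 0 := by
      have h1 := (hud t₀ hV₀).deriv.symm.trans hder0
      rw [Complex.inner] at h1
      rw [mul_comm]
      linarith
    have hpos : 0 < deriv (deriv u) t₀ := by
      rw [(hudd t₀ hV₀).deriv, real_inner_self_eq_norm_sq, Complex.inner]
      have hγ₁0 : γ₁ t₀ ≠ 0 := mul_ne_zero (inv_ne_zero (hne t₀ hV₀)) hd0
      have hconv := one_add_re_preSchwarzian_pos hd hinj (mem_ball_zero_iff.mp (hγV t₀ hV₀).1)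
      set S := deriv (deriv h) (γ t₀) / deriv h (γ t₀)
      have h1 : γ t₀ * conj (γ₁ t₀) = -(conj (γ t₀) * γ₁ t₀) := by
        have h2 := add_conj (conj (γ t₀) * γ₁ t₀)
        rw [hin0, map_mul, conj_conj] at h2
        simp at h2
        linear_combination h2
      have h3 : -γ₁ t₀ ^ 2 * S * conj (γ t₀) = ((‖γ₁ t₀‖ ^ 2 : ℝ) : ℂ) * (γ t₀ * S) := by
        rw [← normSq_eq_norm_sq, ← mul_conj]
        linear_combination (-γ₁ t₀ * S) * h1
      have h5 : 0 < ‖γ₁ t₀‖ ^ 2 := by positivity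
      have h6 : 0 < ‖γ₁ t₀‖ ^ 2 * (1 + (γ t₀ * S).re) := mul_pos h5 hconv
      have h7 : (-γ₁ t₀ ^ 2 * S * conj (γ t₀)).re = ‖γ₁ t₀‖ ^ 2 * (γ t₀ * S).re := by
        rw [h3, re_ofReal_mul]
      rw [h7]
      linarith
    -- A point that is both a local minimum and a local maximum makes `u` locally constant, against
    -- `u'' > 0`.
    have hmin := isLocalMin_of_deriv_deriv_pos hpos hder0 (hud t₀ hV₀).continuousAt
    have hconst : u =ᶠ[𝓝 t₀] fun _ => u t₀ := by
      filter_upwards [hmin, hloc] with s h1 h2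
      exact le_antisymm h2 h1
    have h0 : deriv (deriv u) t₀ = 0 := by
      rw [hconst.deriv.deriv_eq]
      simp
    linarith
  have hut : ‖γ t‖ ^ 2 ≤ ‖γ t₀‖ ^ 2 := hmax ht
  rw [sq_le_sq₀ (norm_nonneg _) (norm_nonneg _)] at hut
  refine hut.trans ?_
  rcases hend with rfl | rfl
  · rw [show γ 0 = a from hy0]; exact le_max_left _ _
  · rw [show γ 1 = c from hy1]; exact le_max_right _ _

/-- **Radius of convexity**: an injective holomorphic function on the unit disk maps closed disks
of radius less than `2 - √3` about `0` to convex sets. -/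
theorem convex_image_closedBall {h : ℂ → ℂ} (hd : DifferentiableOn ℂ h (ball 0 1))
    (hinj : InjOn h (ball 0 1)) {ρ : ℝ} (hρ : ρ < 2 - Real.sqrt 3) :
    Convex ℝ (h '' closedBall 0 ρ) := by
  have hρ1 := hρ.trans two_sub_sqrt_three_lt_one
  have hK1 : closedBall (0 : ℂ) ρ ⊆ ball 0 1 := closedBall_subset_ball hρ1
  have hKr : closedBall (0 : ℂ) ρ ⊆ ball 0 (2 - Real.sqrt 3) := closedBall_subset_ball hρ
  have hsub : ball (0 : ℂ) (2 - Real.sqrt 3) ⊆ ball 0 1 :=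
    ball_subset_ball two_sub_sqrt_three_lt_one.le
  have hKc : IsClosed (h '' closedBall 0 ρ) :=
    ((isCompact_closedBall _ _).image_of_continuousOn (hd.continuousOn.mono hK1)).isClosed
  rw [convex_iff_segment_subset]
  rintro _ ⟨a, ha, rfl⟩ _ ⟨c, hc, rfl⟩
  set p : ℝ → ℂ := fun s => a + s * (c - a) with hp
  have hpc : Continuous p := by simp only [hp]; fun_prop
  have hpK : ∀ s ∈ Icc (0 : ℝ) 1, p s ∈ closedBall (0 : ℂ) ρ := by
    intro s hs
    have := (convex_closedBall (0 : ℂ) ρ).add_smul_sub_mem ha hc hs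
    simpa [hp] using this
  have hhp : ∀ s ∈ Icc (0 : ℝ) 1, ContinuousAt (fun s => h (p s)) s := fun s hs =>
    ((hd.differentiableAt (isOpen_ball.mem_nhds (hK1 (hpK s hs)))).continuousAt).comp
      hpc.continuousAt
  -- Continuity method: the end point moves from `a` to `c` inside the closed disk, and `A` collects
  -- the parameters for which the segment from `h a` stays in the image.
  set A : Set ℝ := {s | ∀ t ∈ Icc (0 : ℝ) 1, h a + t * (h (p s) - h a) ∈ h '' closedBall 0 ρ}
    with hA
  have hAcl : IsClosed (A ∩ Icc 0 1) := by
    have : A ∩ Icc 0 1 = ⋂ t ∈ Icc (0 : ℝ) 1,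
        Icc (0 : ℝ) 1 ∩ (fun s => h a + t * (h (p s) - h a)) ⁻¹' (h '' closedBall 0 ρ) := by
      ext s
      simp only [mem_inter_iff, mem_iInter, mem_preimage]
      constructor
      · exact fun hs t ht => ⟨hs.2, hs.1 t ht⟩
      · exact fun hs => ⟨fun t ht => (hs t ht).2, (hs 0 (by simp)).1⟩
    rw [this]
    refine isClosed_biInter fun t _ => ContinuousOn.preimage_isClosed_of_isClosed ?_ isClosed_Icc hKc
    intro s hs
    exact (continuousAt_const.add (continuousAt_const.mul
      ((hhp s hs).sub continuousAt_const))).continuousWithinAt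
  have hA0 : (0 : ℝ) ∈ A := by
    intro t _
    refine ⟨a, ha, ?_⟩
    simp [hp]
  -- Nearby segments still lie in the open image of the larger disk, and the end-point maximum for
  -- the modulus of the preimages pulls them back into the image of the closed disk.
  have hAopen : ∀ s ∈ A ∩ Ico 0 1, A ∈ 𝓝[>] s := by
    rintro s ⟨hsA, hs⟩
    have hev : ∀ᶠ s' in 𝓝 s, ∀ t ∈ Icc (0 : ℝ) 1,
        h a + t * (h (p s') - h a) ∈ h '' ball 0 (2 - Real.sqrt 3) := by
      refine isCompact_Icc.eventually_forall_of_forall_eventually fun t ht => ?_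
      have hcont : ContinuousAt (fun x : ℝ × ℝ => h a + x.2 * (h (p x.1) - h a)) (s, t) := by
        have h1 : ContinuousAt (fun x : ℝ × ℝ => h (p x.1)) (s, t) :=
          ContinuousAt.comp (f := Prod.fst) (g := fun s => h (p s))
            (hhp s ⟨hs.1, hs.2.le⟩) continuousAt_fst
        have h2 : ContinuousAt (fun x : ℝ × ℝ => (x.2 : ℂ)) (s, t) := by fun_prop
        exact continuousAt_const.add (h2.mul (h1.sub continuousAt_const))
      refine hcont.eventually_mem ?_
      exact (isOpen_image_of_injOn isOpen_ball hd hinj isOpen_ball hsub).mem_nhds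
        (image_mono hKr (hsA t ht))
    filter_upwards [hev.filter_mono nhdsWithin_le_nhds, self_mem_nhdsWithin,
      (eventually_lt_nhds hs.2).filter_mono nhdsWithin_le_nhds] with s' h1 h2 h3 t ht
    have h2 : s < s' := h2
    have hs'K := hpK s' ⟨hs.1.trans h2.le, h3.le⟩
    have hle := norm_invFunOn_segment_le hd hinj (mem_ball_zero_iff.mp (hK1 ha))
      (mem_ball_zero_iff.mp (hK1 hs'K)) h1 ht
    refine ⟨_, ?_, Function.invFunOn_eq (image_mono hsub (h1 t ht))⟩
    rw [mem_closedBall_zero_iff]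
    exact hle.trans (max_le (by simpa using ha) (by simpa using hs'K))
  have hall := hAcl.Icc_subset_of_forall_mem_nhdsWithin hA0 hAopen
  rw [segment_eq_image']
  rintro _ ⟨t, ht, rfl⟩
  have := hall (right_mem_Icc.mpr zero_le_one) t ht
  simpa [hp] using this

/-! ### Injectivity by contraction -/

/-- A multiplier mapping is injective in the disk of radius `2 - √3`. -/
theorem IsMultiplierMapping.injOn {f h g w : ℂ → ℂ} (hf : IsMultiplierMapping f h g w) :
    InjOn f (disk (2 - Real.sqrt 3)) := by
  intro z₁ hz₁ z₂ hz₂ heq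
  have hd : DifferentiableOn ℂ h (ball 0 1) := hf.normalized.holo_h
  have hgd : DifferentiableOn ℂ g (ball 0 1) := hf.normalized.holo_g
  have hinj : InjOn h (ball 0 1) := hf.injOn_h
  set ρ := max ‖z₁‖ ‖z₂‖ with hρdef
  have hρ : ρ < 2 - Real.sqrt 3 := by
    apply max_lt
    · simpa [disk] using hz₁
    · simpa [disk] using hz₂
  have hK₁ : z₁ ∈ closedBall (0 : ℂ) ρ := by simp [hρdef]
  have hK₂ : z₂ ∈ closedBall (0 : ℂ) ρ := by simp [hρdef]
  have hKr : closedBall (0 : ℂ) ρ ⊆ disk (2 - Real.sqrt 3) := closedBall_subset_ball hρ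
  have hK1 : closedBall (0 : ℂ) ρ ⊆ ball 0 1 :=
    closedBall_subset_ball (hρ.trans two_sub_sqrt_three_lt_one)
  have hne : ∀ z ∈ closedBall (0 : ℂ) ρ, deriv h z ≠ 0 := fun z hz =>
    deriv_ne_zero_of_injOn isOpen_ball hd hinj (hK1 hz)
  have hcont : ContinuousOn (fun z => ‖deriv g z * (deriv h z)⁻¹‖) (closedBall 0 ρ) :=
    ((((hgd.deriv isOpen_ball).continuousOn).mono hK1).mul
      ((((hd.deriv isOpen_ball).continuousOn).mono hK1).inv₀ hne)).norm
  obtain ⟨z₀, hz₀, hmax⟩ := (isCompact_closedBall (0 : ℂ) ρ).exists_isMaxOn ⟨z₁, hK₁⟩ hcont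
  -- The maximum is attained on the compact disk, so the pointwise strict bound on the dilatation
  -- becomes a uniform contraction constant.
  set C := ‖deriv g z₀ * (deriv h z₀)⁻¹‖ with hC
  have hC1 : C < 1 := by
    rw [hC, norm_mul, norm_inv, ← div_eq_mul_inv, div_lt_one (norm_pos_iff.mpr (hne z₀ hz₀))]
    exact hf.norm_deriv_lt (hKr hz₀)
  set k := Function.invFunOn h (ball 0 1) with hk
  have hkh : ∀ x ∈ ball (0 : ℂ) 1, k (h x) = x := fun x hx => hinj.leftInvOn_invFunOn hx
  have hder : ∀ y ∈ h '' closedBall 0 ρ, HasDerivWithinAt (fun y => g (k y))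
      (deriv g (k y) * (deriv h (k y))⁻¹) (h '' closedBall 0 ρ) y := by
    rintro _ ⟨x, hx, rfl⟩
    have h1 := hasDerivAt_invFunOn isOpen_ball hd hinj (hK1 hx)
    rw [← hk] at h1
    have h2 := (hgd.differentiableAt (isOpen_ball.mem_nhds (hK1 hx))).hasDerivAt
    rw [hkh x (hK1 hx)]
    have h3 : HasDerivAt g (deriv g x) (k (h x)) := by rw [hkh x (hK1 hx)]; exact h2
    exact (h3.comp (h x) h1).hasDerivWithinAt
  have hle := (convex_image_closedBall hd hinj hρ).norm_image_sub_le_of_norm_hasDerivWithin_le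
    (C := C) hder (by
      rintro _ ⟨x, hx, rfl⟩
      rw [hkh x (hK1 hx)]
      exact hmax hx) (mem_image_of_mem h hK₁) (mem_image_of_mem h hK₂)
  simp only [hkh z₁ (hK1 hK₁), hkh z₂ (hK1 hK₂)] at hle
  rw [hf.normalized.decomp z₁ (hK1 hK₁), hf.normalized.decomp z₂ (hK1 hK₂)] at heq
  have h1 : h z₂ - h z₁ = -conj (g z₂ - g z₁) := by
    rw [map_sub]
    linear_combination -heq
  have h2 : ‖g z₂ - g z₁‖ = ‖h z₂ - h z₁‖ := by rw [h1, norm_neg, RCLike.norm_conj]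
  rw [h2] at hle
  have h3 : ‖h z₂ - h z₁‖ = 0 := by
    have := norm_nonneg (h z₂ - h z₁)
    nlinarith
  exact (hinj (hK1 hK₂) (hK1 hK₁) (sub_eq_zero.mp (norm_eq_zero.mp h3))).symm

/-! ### Sharpness -/

/-- The Koebe function. -/
noncomputable def koebe (z : ℂ) : ℂ := z / (1 - z) ^ 2

theorem one_sub_ne_zero_of_mem_ball {z : ℂ} (hz : z ∈ ball (0 : ℂ) 1) : 1 - z ≠ 0 := by
  intro h
  rw [← sub_eq_zero.mp h] at hz
  simp at hz

theorem hasDerivAt_koebe {z : ℂ} (hz : z ∈ ball (0 : ℂ) 1) :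
    HasDerivAt koebe ((1 + z) / (1 - z) ^ 3) z := by
  have hne := one_sub_ne_zero_of_mem_ball hz
  refine ((hasDerivAt_id z).div (((hasDerivAt_id z).const_sub 1).pow 2)
    (pow_ne_zero 2 hne)).congr_deriv ?_
  simp
  field_simp
  ring

theorem injOn_koebe : InjOn koebe (ball 0 1) := by
  intro x hx y hy hxy
  have hx1 := one_sub_ne_zero_of_mem_ball hx
  have hy1 := one_sub_ne_zero_of_mem_ball hy
  rw [koebe, koebe, div_eq_div_iff (pow_ne_zero 2 hx1) (pow_ne_zero 2 hy1)] at hxy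
  have h1 : (x - y) * (1 - x * y) = 0 := by linear_combination hxy
  refine sub_eq_zero.mp ((mul_eq_zero.mp h1).resolve_right ?_)
  apply one_sub_ne_zero_of_mem_ball
  rw [mem_ball_zero_iff] at hx hy ⊢
  rw [norm_mul]
  nlinarith [norm_nonneg x, norm_nonneg y]

/-- The Koebe function with a Blaschke factor as multiplier is a multiplier mapping. -/
theorem isMultiplierMapping_koebe {a : ℝ} (ha0 : 0 < a) (ha1 : a < 1) :
    IsMultiplierMapping (fun z => koebe z + conj (diskAut (-a) z * koebe z)) koebe
      (fun z => diskAut (-a) z * koebe z) (diskAut (-a)) := by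
  have han : ‖(-a : ℂ)‖ < 1 := by
    rw [norm_neg, norm_real, Real.norm_eq_abs, abs_of_pos ha0]
    exact ha1
  have hk : DifferentiableOn ℂ koebe (disk 1) := fun z hz =>
    (hasDerivAt_koebe hz).differentiableAt.differentiableWithinAt
  have hw : DifferentiableOn ℂ (diskAut (-a)) (disk 1) := fun z hz =>
    (hasDerivAt_diskAut (one_add_conj_mul_ne_zero han
      (mem_ball_zero_iff.mp hz))).differentiableAt.differentiableWithinAt
  have hm : (0 : ℂ) ∈ disk 1 := mem_ball_self one_pos
  refine ⟨⟨?_, hk, hw.mul hk, fun z _ => rfl, by simp [koebe], ?_, by simp [koebe]⟩, injOn_koebe,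
    ⟨hw, fun z hz => (norm_diskAut_lt_one han (mem_ball_zero_iff.mp hz)).le⟩, ?_, fun z _ => rfl⟩
  · intro z hz
    have hn : disk 1 ∈ 𝓝 z := isOpen_ball.mem_nhds hz
    exact ((hk.analyticAt hn).harmonicAt).add (((hw.mul hk).analyticAt hn).harmonicAt_conj)
  · rw [(hasDerivAt_koebe hm).deriv]
    simp
  · rintro ⟨c, hc, hcw⟩
    have := hcw 0 hm
    rw [diskAut_zero] at this
    rw [this] at han
    linarith

/-- Beyond the radius `2 - √3` there are multiplier mappings that are neither sense-preserving nor
injective. -/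
theorem exists_isMultiplierMapping_not_injOn {r : ℝ} (hr : 2 - Real.sqrt 3 < r) (hr1 : r ≤ 1) :
    ∃ f h g w : ℂ → ℂ, IsMultiplierMapping f h g w ∧
      ¬ SensePreservingOn f (disk r) ∧ ¬ InjOn f (disk r) := by
  obtain ⟨ρ, hρ, hρr⟩ := exists_between hr
  have h3 : Real.sqrt 3 ^ 2 = 3 := Real.sq_sqrt (by norm_num)
  have h32 : Real.sqrt 3 < 2 := by nlinarith [Real.sqrt_nonneg 3]
  have hρ0 : 0 < ρ := by linarith
  have hρ1 : ρ < 1 := by linarith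
  have hρ4 : 1 + ρ ^ 2 < 4 * ρ := by nlinarith [Real.sqrt_nonneg 3]
  -- At `a = 1` the inequality reduces to `(1 - ρ)² < 2 ρ`, which holds beyond `2 - √3`. The value
  -- `a = 1` itself is not allowed, since the Blaschke factor becomes the constant `-1`; continuity
  -- provides some `a < 1`.
  obtain ⟨a, ha0, ha1, haE⟩ : ∃ a : ℝ, 0 < a ∧ a < 1 ∧
      (1 - ρ) ^ 2 * (1 + a * ρ) < (1 + a) * ρ * (1 + ρ) := by
    have hc1 : ContinuousAt (fun a : ℝ => (1 - ρ) ^ 2 * (1 + a * ρ)) 1 := by fun_prop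
    have hc2 : ContinuousAt (fun a : ℝ => (1 + a) * ρ * (1 + ρ)) 1 := by fun_prop
    have hev := (hc1.eventually_lt hc2 (by nlinarith)).filter_mono
      (nhdsWithin_le_nhds (s := Iio 1))
    obtain ⟨a, ⟨h1, h2⟩, h4⟩ := ((hev.and self_mem_nhdsWithin).and
      ((eventually_gt_nhds (zero_lt_one' ℝ)).filter_mono nhdsWithin_le_nhds)).exists
    exact ⟨a, h4, h2, h1⟩
  set w := diskAut (-a) with hw
  set g : ℂ → ℂ := fun z => w z * koebe z with hg
  have hmap := isMultiplierMapping_koebe ha0 ha1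
  have hrel : ∀ x : ℝ, x ∈ Ioo (-1 : ℝ) 1 → (x : ℂ) ∈ ball (0 : ℂ) 1 := fun x hx => by
    rw [mem_ball_zero_iff, norm_real, Real.norm_eq_abs, abs_lt]
    exact hx
  have han : ‖(-a : ℂ)‖ < 1 := by
    rw [norm_neg, norm_real, Real.norm_eq_abs, abs_of_pos ha0]
    exact ha1
  have hgd : ∀ x : ℝ, x ∈ Ioo (-1 : ℝ) 1 → HasDerivAt g
      (((1 - a ^ 2) / (1 - a * x) ^ 2 * (x / (1 - x) ^ 2) +
        (x - a) / (1 - a * x) * ((1 + x) / (1 - x) ^ 3) : ℝ) : ℂ) x := by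
    intro x hx
    have h1 := (hasDerivAt_diskAut (one_add_conj_mul_ne_zero han
      (mem_ball_zero_iff.mp (hrel x hx)))).mul (hasDerivAt_koebe (hrel x hx))
    refine h1.congr_deriv ?_
    have e : 1 + conj (-a : ℂ) * x = 1 - a * x := by simp; ring
    rw [e, norm_neg, norm_real, Real.norm_eq_abs, abs_of_pos ha0, diskAut, e, koebe]
    push_cast
    ring
  have hkd : ∀ x : ℝ, x ∈ Ioo (-1 : ℝ) 1 →
      HasDerivAt koebe (((1 + x) / (1 - x) ^ 3 : ℝ) : ℂ) x := by
    intro x hx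
    refine (hasDerivAt_koebe (hrel x hx)).congr_deriv ?_
    push_cast
    ring
  set φ : ℝ → ℝ := fun x => (koebe x + g x).re with hφ
  have hφd := fun (x : ℝ) hx => ((hkd x hx).add (hgd x hx)).real_of_complex
  have hρm : -ρ ∈ Ioo (-1 : ℝ) 1 := ⟨by linarith, by linarith⟩
  have h0m : (0 : ℝ) ∈ Ioo (-1 : ℝ) 1 := ⟨by norm_num, by norm_num⟩
  set H := (1 + -ρ) / (1 - -ρ) ^ 3 with hH
  set v := (1 - a ^ 2) / (1 - a * -ρ) ^ 2 * (-ρ / (1 - -ρ) ^ 2) +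
        (-ρ - a) / (1 - a * -ρ) * ((1 + -ρ) / (1 - -ρ) ^ 3) with hv
  have hHpos : 0 < H := div_pos (by linarith) (pow_pos (by linarith) 3)
  -- `H` and `v` are the values of `h'` and `g'` at `-ρ`. From `H > 0` and `H + v < 0` it follows
  -- that `v² > H²`, so the Jacobian is negative there, and `H + v` is the slope of `f` along the
  -- real axis.
  have hneg : H + v < 0 := by
    have e : H + v = (1 - a) / ((1 + a * ρ) ^ 2 * (1 + ρ) ^ 3) *
        ((1 - ρ) ^ 2 * (1 + a * ρ) - (1 + a) * ρ * (1 + ρ)) := by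
      have : 1 + ρ ≠ 0 := by positivity
      have : 1 + a * ρ ≠ 0 := by positivity
      rw [hH, hv, mul_neg, sub_neg_eq_add, sub_neg_eq_add]
      field_simp
      ring
    rw [e]
    apply mul_neg_of_pos_of_neg
    · apply div_pos <;> [linarith; positivity]
    · linarith
  refine ⟨_, _, _, _, hmap, fun hsp => ?_, fun hinj => ?_⟩
  · have hmem : ((-ρ : ℝ) : ℂ) ∈ disk r := by
      rw [disk, mem_ball_zero_iff, norm_real, Real.norm_eq_abs, abs_neg, abs_of_pos hρ0]
      exact hρr
    have h1 := hsp _ hmem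
    rw [hmap.normalized.jacobian_eq (hrel _ hρm), (hkd _ hρm).deriv, (hgd _ hρm).deriv, norm_real,
      norm_real, Real.norm_eq_abs, Real.norm_eq_abs, sq_abs, sq_abs, ← hH, ← hv] at h1
    nlinarith
  · have hreal : ∀ x : ℝ, koebe x + conj (g x) = (φ x : ℂ) := by
      intro x
      have e1 : koebe x = ((x / (1 - x) ^ 2 : ℝ) : ℂ) := by simp [koebe]
      have e2 : g x = (((x - a) / (1 - a * x) * (x / (1 - x) ^ 2) : ℝ) : ℂ) := by
        simp only [hg, e1, hw, diskAut]
        push_cast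
        simp
        ring_nf
        simp
      simp only [hφ]
      rw [e1, e2, conj_ofReal, ← ofReal_add, ofReal_re]
    have hr0 : 0 < r := by linarith
    have hsub : Ioo (-r) r ⊆ Ioo (-1 : ℝ) 1 := Ioo_subset_Ioo (by linarith) hr1
    have hφinj : InjOn φ (Ioo (-r) r) := by
      intro x hx y hy hxy
      have hm : ∀ x ∈ Ioo (-r) r, (x : ℂ) ∈ disk r := fun x hx => by
        rw [disk, mem_ball_zero_iff, norm_real, Real.norm_eq_abs, abs_lt]
        exact hx
      have := hinj (hm x hx) (hm y hy) (by
        change koebe x + conj (g x) = koebe y + conj (g y)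
        rw [hreal, hreal, hxy])
      exact_mod_cast this
    have hφc : ContinuousOn φ (Ioo (-r) r) := fun x hx =>
      (hφd x (hsub hx)).continuousAt.continuousWithinAt
    -- A continuous injective real function on an interval is strictly monotone; the slope at `-ρ`
    -- rules out increasing, the slope `1 - a > 0` at `0` rules out decreasing.
    rcases hφc.strictMonoOn_of_injOn_Ioo (by linarith) hφinj with hm | hm
    · have hx : -ρ ∈ Ioo (-r) r := ⟨by linarith, by linarith⟩
      have h1 := hm.monotoneOn.derivWithin_nonneg (x := -ρ)
      rw [derivWithin_of_isOpen isOpen_Ioo hx] at h1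
      have h2 := (hφd _ hρm).deriv
      rw [← ofReal_add, ofReal_re] at h2
      have h4 : deriv φ (-ρ) = H + v := h2
      linarith
    · have hx : (0 : ℝ) ∈ Ioo (-r) r := ⟨by linarith, by linarith⟩
      have h1 := hm.antitoneOn.derivWithin_nonpos (x := 0)
      rw [derivWithin_of_isOpen isOpen_Ioo hx] at h1
      have h2 := (hφd _ h0m).deriv
      rw [← ofReal_add, ofReal_re] at h2
      have h4 : deriv φ 0 = 1 - a := by
        refine h2.trans ?_
        simp
        ring
      linarith

theorem theorem2p5 :
    (∀ f h g w : ℂ → ℂ, IsMultiplierMapping f h g w →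
      SensePreservingOn f (disk (2 - Real.sqrt 3)) ∧
        Set.InjOn f (disk (2 - Real.sqrt 3))) ∧
    (∀ r : ℝ, 2 - Real.sqrt 3 < r → r ≤ 1 →
      ∃ f h g w : ℂ → ℂ, IsMultiplierMapping f h g w ∧
        ¬ SensePreservingOn f (disk r) ∧ ¬ Set.InjOn f (disk r)) := by
  refine ⟨fun f h g w hf => ⟨fun z hz => ?_, hf.injOn⟩, fun r hr hr1 =>
    exists_isMultiplierMapping_not_injOn hr hr1⟩
  have hz1 : z ∈ disk 1 := ball_subset_ball two_sub_sqrt_three_lt_one.le hz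
  rw [hf.normalized.jacobian_eq hz1]
  have := hf.norm_deriv_lt hz
  have := norm_nonneg (deriv g z)
  nlinarith
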